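/- Fix $n,p\in\mathbb N$, $\sigma>0$, $\alpha>0$, $\theta_0\in\mathbb R^n$ and a deterministic input $u$ with $u(t)=0$ for $t<0$. For each $N$ consider the finite impulse response model $Y=\Phi\theta_0+E$ with $E\sim\mathcal N(0,\sigma^2 I_N)$, where $\Phi=\Phi_N\in\mathbb R^{N\times n}$ is the lower triangular Toeplitz matrix with first column $(u(0),\dots,u(N-1))^\top$. Assume that $\Phi$ has rank $n$ for all large $N$ and that $\Phi^\top\Phi/N\to\Sigma\succ0$ as $N\to\infty$. Let $D\subset\mathbb R^p$ be compact and let $P:D\to\mathbb R^{n\times n}$ be continuous, with $P(\eta)$ symmetric positive definite for every $\eta\in D$, and twice continuously differentiable in the interior of $D$. Put $$W(\theta,\eta)=\theta^\top P(\eta)^{-1}\theta+\alpha\log\det P(\eta),$$ and assume that $W(\theta_0,\cdot)$ has a unique minimizer $\eta_\star$ over $D$, that $\eta_\star$ lies in the interior of $D$, and that $\partial^2W(\theta_0,\eta)/\partial\eta\,\partial\eta^\top\succ0$ at $\eta=\eta_\star$. Let $\hat\theta^{\rm ML}=(\Phi^\top\Phi)^{-1}\Phi^\top Y$ and $\hat\theta^{\rm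 R}(\eta)=[\Phi^\top\Phi+\sigma^2P(\eta)^{-1}]^{-1}\Phi^\top Y$. Let $\hat\eta=\hat\eta_N(Y)$ be a measurable selection with $$\hat\eta\in\operatorname*{arg\,min}_{\eta\in D}\;\bigl\{Y^\top Q(\eta)^{-1}Y+\alpha\log\det Q(\eta)\bigr\},\qquad Q(\eta)=\Phi P(\eta)\Phi^\top+\sigma^2I_N .$$ Write $\mathrm{MSE}(\hat\theta)=\mathbb E\|\hat\theta-\theta_0\|_2^2$. Define $A(\eta)\in\mathbb R^{p\times p}$ and $B(\eta)\in\mathbb R^{p\times n}$ by $$[A]_{k,l}=\theta_0^\top\frac{\partial^2P^{-1}}{\partial\eta_k\partial\eta_l}\theta_0+\alpha\operatorname{Tr}\Bigl[P^{-1}\frac{\partial^2P}{\partial\eta_k\partial\eta_l}\Bigr]+\alpha\operatorname{Tr}\Bigl[\frac{\partial P^{-1}}{\partial\eta_l}\frac{\partial P}{\partial\eta_k}\Bigr],\qquad [B]_{k,:}=2\theta_0^\top\frac{\partial P^{-1}}{\partial\eta_k},$$ and put $$b(\eta)=-\sigma^2\Sigma^{-1}P(\eta)^{-1}\theta_0,\qquad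 b_\theta'(\eta)=-\sigma^2\Sigma^{-1}P(\eta)^{-1},\qquad [b_\eta'(\eta)]_{:,k}=-\sigma^2\Sigma^{-1}\frac{\partial P(\eta)^{-1}}{\partial\eta_k}\theta_0 .$$ Then the following hold. 1. For every $\eta$ in the interior of $D$, $A(\eta)=\partial^2W(\theta_0,\eta)/\partial\eta\,\partial\eta^\top$ and $B(\eta)=\partial^2W(\theta_0,\eta)/\partial\eta\,\partial\theta_0^\top$. 2. For every $\eta$ in the interior of $D$, regarding $\hat\theta^{\rm R}(\eta)$ as a function of $\hat\theta^{\rm ML}$ and of $\eta$, as $N\to\infty$ and at $\hat\theta^{\rm ML}=\theta_0$: $N[\hat\theta^{\rm R}(\eta)-\theta_0]\to b(\eta)$, $N[\partial\hat\theta^{\rm R}(\eta)/\partial\hat\theta^{\rm ML}-I_n]\to b'_\theta(\eta)$ and $N\,\partial\hat\theta^{\rm R}(\eta)/\partial\eta\to b'_\eta(\eta)$. 3. For all large $N$, whenever $\hat\theta^{\rm ML}$ lies in some neighbourhood (depending on $N$) of $\theta_0$, $\hat\eta$ is a function $\zeta_N(\hat\theta^{\rm ML})$ of $\hat\theta^{\rm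 ML}$, and $\zeta_N$ is differentiable at $\theta_0$. Moreover $\zeta_N(\theta_0)\to\eta_\star$, and the Jacobian of $\zeta_N$ at $\theta_0$ tends to $-A(\eta_\star)^{-1}B(\eta_\star)$. 4. $\mathrm{MSE}(\hat\theta^{\rm R}(\hat\eta))$ and $\mathrm{MSE}(\hat\theta^{\rm ML})$ are finite, and the excess MSE exists and equals $$\lim_{N\to\infty}N^2\bigl[\mathrm{MSE}(\hat\theta^{\rm R}(\hat\eta))-\mathrm{MSE}(\hat\theta^{\rm ML})\bigr]=\|b(\eta_\star)\|_2^2+\operatorname{Tr}[V+V^\top]+\operatorname{Tr}[H+H^\top],$$ where $V=\sigma^2\,b_\theta'(\eta_\star)\Sigma^{-1}$ and $H=-\sigma^2\,b_\eta'(\eta_\star)A(\eta_\star)^{-1}B(\eta_\star)\Sigma^{-1}$. (Where $\Phi^\top\Phi$ is singular, which can happen only for finitely many $N$, its inverse is read as $0$.) -/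

import Mathlib

open Matrix MeasureTheory ProbabilityTheory Filter Topology

noncomputable section

namespace FIR

/-- Partial derivative of a real function with respect to its `k`-th coordinate. -/
def pderiv {p : ℕ} (k : Fin p) (f : (Fin p → ℝ) → ℝ) (x : Fin p → ℝ) : ℝ :=
  lineDeriv ℝ f x (Pi.single k 1)

/-- Entrywise partial derivative of a matrix-valued function. -/
def mpderiv {p m n : ℕ} (k : Fin p) (M : (Fin p → ℝ) → Matrix (Fin m) (Fin n) ℝ)
    (x : Fin p → ℝ) : Matrix (Fin m) (Fin n) ℝ :=
  Matrix.of fun i j => pderiv k (fun z => M z i j) x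

/-- Jacobian matrix: entry `(i, j)` is the `j`-th partial derivative of the `i`-th component. -/
def jacobian {p m : ℕ} (f : (Fin p → ℝ) → (Fin m → ℝ)) (x : Fin p → ℝ) :
    Matrix (Fin m) (Fin p) ℝ :=
  Matrix.of fun i j => pderiv j (fun z => f z i) x

/-- Hessian matrix of a real function. -/
def hessian {p : ℕ} (f : (Fin p → ℝ) → ℝ) (x : Fin p → ℝ) : Matrix (Fin p) (Fin p) ℝ :=
  Matrix.of fun k l => pderiv k (fun z => pderiv l f z) x

/-- The regression matrix of the model `y(t) = ∑_{k=1}^n g_k u(t-k) + e(t)`, `t = 1, …, N`.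
Row `i` stands for `t = i + 1` and column `j` for `k = j + 1`, so that the entry is
`u(t - k) = u(i - j)`. -/
def regressor (u : ℤ → ℝ) (N n : ℕ) : Matrix (Fin N) (Fin n) ℝ :=
  Matrix.of fun i j => u ((i : ℤ) - (j : ℤ))

/-- Maximum likelihood (least squares) estimate `(ΦᵀΦ)⁻¹ Φᵀ Y`. -/
def mlEstimate {N n : ℕ} (Φ : Matrix (Fin N) (Fin n) ℝ) (y : Fin N → ℝ) : Fin n → ℝ :=
  (Φᵀ * Φ)⁻¹ *ᵥ (Φᵀ *ᵥ y)

/-- Regularized estimate `(ΦᵀΦ + σ² K⁻¹)⁻¹ Φᵀ Y` with kernel matrix `K`. -/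
def regEstimate {N n : ℕ} (Φ : Matrix (Fin N) (Fin n) ℝ) (σ : ℝ) (K : Matrix (Fin n) (Fin n) ℝ)
    (y : Fin N → ℝ) : Fin n → ℝ :=
  (Φᵀ * Φ + σ ^ 2 • K⁻¹)⁻¹ *ᵥ (Φᵀ *ᵥ y)

/-- `Q = Φ K Φᵀ + σ² I_N`. -/
def outputCov {N n : ℕ} (Φ : Matrix (Fin N) (Fin n) ℝ) (σ : ℝ) (K : Matrix (Fin n) (Fin n) ℝ) :
    Matrix (Fin N) (Fin N) ℝ :=
  Φ * K * Φᵀ + σ ^ 2 • (1 : Matrix (Fin N) (Fin N) ℝ)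

/-- Scaled empirical Bayes cost `Yᵀ Q⁻¹ Y + α log det Q`. -/
def ebCost {N n : ℕ} (Φ : Matrix (Fin N) (Fin n) ℝ) (σ α : ℝ) (K : Matrix (Fin n) (Fin n) ℝ)
    (y : Fin N → ℝ) : ℝ :=
  y ⬝ᵥ ((outputCov Φ σ K)⁻¹ *ᵥ y) + α * Real.log (outputCov Φ σ K).det

/-- Law of the noise vector: `N` independent centred Gaussians of variance `σ²`. -/
def noise (N : ℕ) (σ : ℝ) : Measure (Fin N → ℝ) :=
  Measure.pi fun _ => gaussianReal 0 (Real.toNNReal (σ ^ 2))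

/-- Squared Euclidean norm. -/
def sqNorm {n : ℕ} (x : Fin n → ℝ) : ℝ := ∑ i, x i ^ 2

/-- Squared error of an estimator, as a function of the noise vector `e`, for data
`Y = Φ θ₀ + e`. -/
def sqError {N n : ℕ} (Φ : Matrix (Fin N) (Fin n) ℝ) (θ₀ : Fin n → ℝ)
    (est : (Fin N → ℝ) → (Fin n → ℝ)) (e : Fin N → ℝ) : ℝ :=
  sqNorm (est (Φ *ᵥ θ₀ + e) - θ₀)

/-- Mean squared error of an estimator. -/
def mse {N n : ℕ} (Φ : Matrix (Fin N) (Fin n) ℝ) (σ : ℝ) (θ₀ : Fin n → ℝ)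
    (est : (Fin N → ℝ) → (Fin n → ℝ)) : ℝ :=
  ∫ e, sqError Φ θ₀ est e ∂(noise N σ)

section Limits

variable {n p : ℕ}

/-- `W(θ, η) = θᵀ P(η)⁻¹ θ + α log det P(η)`. -/
def W (α : ℝ) (P : (Fin p → ℝ) → Matrix (Fin n) (Fin n) ℝ) (θ : Fin n → ℝ) (η : Fin p → ℝ) : ℝ :=
  θ ⬝ᵥ ((P η)⁻¹ *ᵥ θ) + α * Real.log (P η).det

/-- The explicit `p × p` matrix `A`. -/
def A (α : ℝ) (P : (Fin p → ℝ) → Matrix (Fin n) (Fin n) ℝ) (θ₀ : Fin n → ℝ) (η : Fin p → ℝ) :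
    Matrix (Fin p) (Fin p) ℝ :=
  Matrix.of fun k l =>
    θ₀ ⬝ᵥ (mpderiv k (fun z => mpderiv l (fun w => (P w)⁻¹) z) η *ᵥ θ₀)
      + α * ((P η)⁻¹ * mpderiv k (fun z => mpderiv l P z) η).trace
      + α * (mpderiv l (fun z => (P z)⁻¹) η * mpderiv k P η).trace

/-- The explicit `p × n` matrix `B`; its `k`-th row is `2 θ₀ᵀ ∂P(η)⁻¹/∂η_k`. -/
def B (P : (Fin p → ℝ) → Matrix (Fin n) (Fin n) ℝ) (θ₀ : Fin n → ℝ) (η : Fin p → ℝ) :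
    Matrix (Fin p) (Fin n) ℝ :=
  Matrix.of fun k => (2 : ℝ) • (θ₀ ᵥ* mpderiv k (fun z => (P z)⁻¹) η)

/-- `b(η) = -σ² Σ⁻¹ P(η)⁻¹ θ₀`. -/
def bias (σ : ℝ) (S : Matrix (Fin n) (Fin n) ℝ) (P : (Fin p → ℝ) → Matrix (Fin n) (Fin n) ℝ)
    (θ₀ : Fin n → ℝ) (η : Fin p → ℝ) : Fin n → ℝ :=
  -(σ ^ 2 • (S⁻¹ *ᵥ ((P η)⁻¹ *ᵥ θ₀)))

/-- `b'_θ(η) = -σ² Σ⁻¹ P(η)⁻¹`. -/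
def biasTheta (σ : ℝ) (S : Matrix (Fin n) (Fin n) ℝ)
    (P : (Fin p → ℝ) → Matrix (Fin n) (Fin n) ℝ) (η : Fin p → ℝ) : Matrix (Fin n) (Fin n) ℝ :=
  -(σ ^ 2 • (S⁻¹ * (P η)⁻¹))

/-- `b'_η(η)`, whose `k`-th column is `-σ² Σ⁻¹ (∂P(η)⁻¹/∂η_k) θ₀`. -/
def biasEta (σ : ℝ) (S : Matrix (Fin n) (Fin n) ℝ) (P : (Fin p → ℝ) → Matrix (Fin n) (Fin n) ℝ)
    (θ₀ : Fin n → ℝ) (η : Fin p → ℝ) : Matrix (Fin n) (Fin p) ℝ :=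
  Matrix.of fun i k => -(σ ^ 2 * (S⁻¹ *ᵥ (mpderiv k (fun z => (P z)⁻¹) η *ᵥ θ₀)) i)

/-- Excess variance for a hyper-parameter frozen at `η`. -/
def XVar (σ : ℝ) (S : Matrix (Fin n) (Fin n) ℝ) (P : (Fin p → ℝ) → Matrix (Fin n) (Fin n) ℝ)
    (η : Fin p → ℝ) : Matrix (Fin n) (Fin n) ℝ :=
  σ ^ 2 • (biasTheta σ S P η * S⁻¹) + (σ ^ 2 • (biasTheta σ S P η * S⁻¹))ᵀ

/-- Excess variance due to the hyper-parameter estimator, whose Jacobian with respect to the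
maximum likelihood estimate tends to `D'`. -/
def XVarHPE (σ : ℝ) (S : Matrix (Fin n) (Fin n) ℝ) (P : (Fin p → ℝ) → Matrix (Fin n) (Fin n) ℝ)
    (θ₀ : Fin n → ℝ) (η : Fin p → ℝ) (D' : Matrix (Fin p) (Fin n) ℝ) : Matrix (Fin n) (Fin n) ℝ :=
  σ ^ 2 • (biasEta σ S P θ₀ η * D' * S⁻¹) + (σ ^ 2 • (biasEta σ S P θ₀ η * D' * S⁻¹))ᵀ

end Limits

end FIR

end

namespace FIR

/-! ### Reduction of the estimator and of the cost to the least squares estimate. -/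

section Algebra

variable {N n p : ℕ}

/-! Write `R = ΦᵀΦ`, `M = σ² R⁻¹`, and let `δ` be the least squares error, a centred Gaussian vector
with covariance `σ² R⁻¹ ~ σ² S⁻¹ / N`. Two exact identities reduce the problem to finite dimension.
The regularized estimate is `θ̂ - σ² R⁻¹ (P + M)⁻¹ θ̂` with `θ̂` the least squares estimate
(`regEstimate_eq_mlEstimate_sub`). The empirical Bayes cost is `W` with `P + M` in place of `P`,
evaluated at `θ̂`, plus a term free of `η` (`ebCost_eq_add`). The data thus enter only through `θ̂`,
and `N` only through `M → 0` and the factor `R⁻¹`.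

So the selected hyper-parameter minimizes a small perturbation of `W(θ₀, ·)`. The implicit function
theorem applied to the gradient at `((0, θ₀), ηstar)` gives a `C¹` branch `ζ(M, θ)` of critical
points whose `θ`-derivative at the base point is `-A⁻¹B`. Compactness of `D` and uniqueness of
`ηstar` keep minimizers away from every other region (`exists_minimizer_function`).

Put `G = N (θ̂ᴿ - θ̂) = -σ² N R⁻¹ (P(η̂) + M)⁻¹ (θ₀ + δ)`. Strict differentiability yields `G = g_N
+ l_N δ + o(‖δ‖)` on a ball of radius independent of `N`, with `g_N → b` and `l_N → b'_θ - b'_η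
A⁻¹B`; outside the ball `G` grows at most linearly, because `(P + M)⁻¹` is bounded over `D`. Finally
`N² (MSE difference) = E‖G‖² + 2 N E[δ·G]`. The first term tends to `‖b‖²` (`tendsto_integral_sq`).
In the second, `E δ = 0` removes `g_N`, the covariance turns `l_N` into a trace, and fourth moments
of order `N⁻²` absorb the region outside the ball (`tendsto_mul_integral_mul`). -/

lemma add_smul_inv_eq {R K : Matrix (Fin n) (Fin n) ℝ} {σ : ℝ} (hR : IsUnit R.det)
    (hK : IsUnit K.det) : R + σ ^ 2 • K⁻¹ = K⁻¹ * (K + σ ^ 2 • R⁻¹) * R := by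
  rw [Matrix.mul_add, Matrix.nonsing_inv_mul _ hK, Matrix.add_mul, Matrix.one_mul,
    Matrix.mul_smul, Matrix.smul_mul, Matrix.mul_assoc, Matrix.nonsing_inv_mul _ hR,
    Matrix.mul_one]

/-- For an invertible Gram matrix `R`, the regularised inverse is `R⁻¹` up to a correction. -/
lemma inv_add_smul_inv_mul {R K : Matrix (Fin n) (Fin n) ℝ} {σ : ℝ} (hR : IsUnit R.det)
    (hK : IsUnit K.det) (hKM : IsUnit (K + σ ^ 2 • R⁻¹).det) :
    (R + σ ^ 2 • K⁻¹)⁻¹ * R = 1 - σ ^ 2 • (R⁻¹ * (K + σ ^ 2 • R⁻¹)⁻¹) := by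
  have h2 : (K + σ ^ 2 • R⁻¹)⁻¹ * K = 1 - σ ^ 2 • ((K + σ ^ 2 • R⁻¹)⁻¹ * R⁻¹) := by
    have := Matrix.nonsing_inv_mul _ hKM
    rw [Matrix.mul_add, Matrix.mul_smul] at this
    exact eq_sub_of_add_eq this
  rw [add_smul_inv_eq hR hK, Matrix.mul_inv_rev, Matrix.mul_inv_rev, Matrix.nonsing_inv_nonsing_inv _ hK, h2]
  have h3 : (K + σ ^ 2 • R⁻¹)⁻¹ * R⁻¹ * R = (K + σ ^ 2 • R⁻¹)⁻¹ := by
    rw [Matrix.mul_assoc, Matrix.nonsing_inv_mul _ hR, Matrix.mul_one]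
  rw [Matrix.mul_assoc, Matrix.sub_mul, Matrix.one_mul, Matrix.smul_mul, h3, Matrix.mul_sub,
    Matrix.nonsing_inv_mul _ hR, Matrix.mul_smul]

lemma gram_mulVec_mlEstimate {Φ : Matrix (Fin N) (Fin n) ℝ} (hR : IsUnit (Φᵀ * Φ).det)
    (y : Fin N → ℝ) : (Φᵀ * Φ) *ᵥ mlEstimate Φ y = Φᵀ *ᵥ y := by
  rw [mlEstimate, Matrix.mulVec_mulVec, Matrix.mul_nonsing_inv _ hR, Matrix.one_mulVec]

lemma mlEstimate_mulVec {Φ : Matrix (Fin N) (Fin n) ℝ} (hR : IsUnit (Φᵀ * Φ).det)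
    (θ : Fin n → ℝ) : mlEstimate Φ (Φ *ᵥ θ) = θ := by
  rw [mlEstimate, Matrix.mulVec_mulVec, Matrix.mulVec_mulVec, Matrix.mul_assoc,
    Matrix.nonsing_inv_mul _ hR, Matrix.one_mulVec]

lemma mlEstimate_add (Φ : Matrix (Fin N) (Fin n) ℝ) (y z : Fin N → ℝ) :
    mlEstimate Φ (y + z) = mlEstimate Φ y + mlEstimate Φ z := by
  simp [mlEstimate, Matrix.mulVec_add]

lemma regEstimate_eq_mlEstimate_sub {Φ : Matrix (Fin N) (Fin n) ℝ} {σ : ℝ}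
    {K : Matrix (Fin n) (Fin n) ℝ} (hR : IsUnit (Φᵀ * Φ).det) (hK : IsUnit K.det)
    (hKM : IsUnit (K + σ ^ 2 • (Φᵀ * Φ)⁻¹).det) (y : Fin N → ℝ) :
    regEstimate Φ σ K y = mlEstimate Φ y -
      σ ^ 2 • ((Φᵀ * Φ)⁻¹ *ᵥ ((K + σ ^ 2 • (Φᵀ * Φ)⁻¹)⁻¹ *ᵥ mlEstimate Φ y)) := by
  rw [regEstimate, ← gram_mulVec_mlEstimate hR, Matrix.mulVec_mulVec,
    inv_add_smul_inv_mul hR hK hKM, Matrix.sub_mulVec, Matrix.one_mulVec, Matrix.smul_mulVec,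
    Matrix.mulVec_mulVec]

/-- This is the Woodbury identity: it trades an `N × N` inverse for an `n × n` one, so that `Y` is
met only through `Φᵀ Y` and `Y·Y`. -/
lemma outputCov_inv {Φ : Matrix (Fin N) (Fin n) ℝ} {σ : ℝ} {K : Matrix (Fin n) (Fin n) ℝ}
    (hσ : σ ≠ 0) (hK : IsUnit K.det) (hZ : IsUnit (Φᵀ * Φ + σ ^ 2 • K⁻¹).det) :
    (outputCov Φ σ K)⁻¹ =
      (σ ^ 2)⁻¹ • (1 - Φ * (Φᵀ * Φ + σ ^ 2 • K⁻¹)⁻¹ * Φᵀ) := by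
  set Z := (Φᵀ * Φ + σ ^ 2 • K⁻¹)⁻¹ with hZdef
  apply Matrix.inv_eq_right_inv
  have hs : σ ^ 2 ≠ 0 := pow_ne_zero 2 hσ
  have h1 : K * (Φᵀ * Φ) * Z + σ ^ 2 • Z = K := by
    have h2 : (K * (Φᵀ * Φ) + σ ^ 2 • (1 : Matrix (Fin n) (Fin n) ℝ)) =
        K * (Φᵀ * Φ + σ ^ 2 • K⁻¹) := by
      rw [Matrix.mul_add, Matrix.mul_smul, Matrix.mul_nonsing_inv _ hK]
    have h3 : (K * (Φᵀ * Φ) + σ ^ 2 • (1 : Matrix (Fin n) (Fin n) ℝ)) * Z = K := by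
      rw [h2, Matrix.mul_assoc, hZdef, Matrix.mul_nonsing_inv _ hZ, Matrix.mul_one]
    rwa [Matrix.add_mul, Matrix.smul_mul, Matrix.one_mul] at h3
  rw [Matrix.mul_smul, inv_smul_eq_iff₀ hs, outputCov, Matrix.mul_sub, Matrix.mul_one,
    Matrix.add_mul, Matrix.smul_mul, Matrix.one_mul]
  have h4 : Φ * K * Φᵀ * (Φ * Z * Φᵀ) + σ ^ 2 • (Φ * Z * Φᵀ) = Φ * K * Φᵀ := by
    conv_rhs => rw [← h1]
    rw [Matrix.mul_add, Matrix.add_mul]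
    simp only [Matrix.mul_assoc, Matrix.mul_smul, Matrix.smul_mul]
  rw [h4, add_sub_cancel_left]

/-- Sylvester's identity `det(1 + XY) = det(1 + YX)` moves the determinant to size `n`; the factors
other than the last do not involve `K` and become additive constants under the logarithm. -/
lemma outputCov_det {Φ : Matrix (Fin N) (Fin n) ℝ} {σ : ℝ} {K : Matrix (Fin n) (Fin n) ℝ}
    (hσ : σ ≠ 0) (hR : IsUnit (Φᵀ * Φ).det) :
    (outputCov Φ σ K).det = (σ ^ 2) ^ N * ((σ ^ 2)⁻¹ ^ n * (Φᵀ * Φ).det) *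
      (K + σ ^ 2 • (Φᵀ * Φ)⁻¹).det := by
  have hs : σ ^ 2 ≠ 0 := pow_ne_zero 2 hσ
  have h1 : outputCov Φ σ K = σ ^ 2 • (1 + Φ * ((σ ^ 2)⁻¹ • (K * Φᵀ))) := by
    rw [outputCov, smul_add, Matrix.mul_smul, smul_inv_smul₀ hs, Matrix.mul_assoc, add_comm]
  have h2 : 1 + (σ ^ 2)⁻¹ • (K * Φᵀ) * Φ =
      (K + σ ^ 2 • (Φᵀ * Φ)⁻¹) * ((σ ^ 2)⁻¹ • (Φᵀ * Φ)) := by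
    rw [Matrix.add_mul, Matrix.mul_smul, Matrix.smul_mul, Matrix.smul_mul, Matrix.mul_smul,
      Matrix.nonsing_inv_mul _ hR, smul_inv_smul₀ hs, Matrix.mul_assoc, add_comm]
  rw [h1, Matrix.det_smul, Matrix.det_one_add_mul_comm, h2, Matrix.det_mul, Matrix.det_smul]
  simp only [Fintype.card_fin]
  ring

/-- Up to a term that does not depend on the kernel matrix, the empirical Bayes cost is a function
of the maximum likelihood estimate, of the same form as the asymptotic cost. -/
lemma ebCost_eq_add {Φ : Matrix (Fin N) (Fin n) ℝ} {σ : ℝ} (α : ℝ) (hσ : σ ≠ 0)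
    (hR : IsUnit (Φᵀ * Φ).det) (hRpos : 0 < (Φᵀ * Φ).det) (y : Fin N → ℝ) :
    ∃ c : ℝ, ∀ K : Matrix (Fin n) (Fin n) ℝ, IsUnit K.det →
      0 < (K + σ ^ 2 • (Φᵀ * Φ)⁻¹).det →
      ebCost Φ σ α K y = mlEstimate Φ y ⬝ᵥ ((K + σ ^ 2 • (Φᵀ * Φ)⁻¹)⁻¹ *ᵥ mlEstimate Φ y)
        + α * Real.log (K + σ ^ 2 • (Φᵀ * Φ)⁻¹).det + c := by
  -- The constant collects the residual sum of squares divided by `σ²` and the `K`-free part of the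
  -- log determinant.
  refine ⟨(σ ^ 2)⁻¹ * (y ⬝ᵥ y - mlEstimate Φ y ⬝ᵥ ((Φᵀ * Φ) *ᵥ mlEstimate Φ y)) +
    α * Real.log ((σ ^ 2) ^ N * ((σ ^ 2)⁻¹ ^ n * (Φᵀ * Φ).det)), fun K hK hKM => ?_⟩
  have hs : 0 < σ ^ 2 := by positivity
  set R := Φᵀ * Φ with hRdef
  set θ := mlEstimate Φ y with hθ
  have hZ : IsUnit (R + σ ^ 2 • K⁻¹).det := by
    rw [add_smul_inv_eq hR hK, Matrix.det_mul, Matrix.det_mul]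
    exact ((Matrix.isUnit_nonsing_inv_det _ hK).mul hKM.ne'.isUnit).mul hR
  rw [ebCost, outputCov_det hσ hR, Real.log_mul (by positivity) hKM.ne', outputCov_inv hσ hK hZ]
  have hΦy : Φᵀ *ᵥ y = R *ᵥ θ := (gram_mulVec_mlEstimate hR y).symm
  have hquad : y ⬝ᵥ ((Φ * (R + σ ^ 2 • K⁻¹)⁻¹ * Φᵀ) *ᵥ y) =
      θ ⬝ᵥ (R *ᵥ θ) - σ ^ 2 * (θ ⬝ᵥ ((K + σ ^ 2 • R⁻¹)⁻¹ *ᵥ θ)) := by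
    have hRt : Rᵀ = R := by rw [hRdef, Matrix.transpose_mul, Matrix.transpose_transpose]
    rw [← Matrix.mulVec_mulVec, ← Matrix.mulVec_mulVec, Matrix.dotProduct_mulVec,
      ← Matrix.mulVec_transpose, hΦy, Matrix.mulVec_mulVec,
      inv_add_smul_inv_mul hR hK hKM.ne'.isUnit, ← Matrix.vecMul_transpose, hRt,
      ← Matrix.dotProduct_mulVec, Matrix.mulVec_mulVec, Matrix.mul_sub, Matrix.mul_one,
      Matrix.mul_smul, ← Matrix.mul_assoc, Matrix.mul_nonsing_inv _ hR, Matrix.one_mul,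
      Matrix.sub_mulVec, dotProduct_sub, Matrix.smul_mulVec, dotProduct_smul, smul_eq_mul,
      ← Matrix.mulVec_transpose, hRt]
  rw [Matrix.smul_mulVec, dotProduct_smul, Matrix.sub_mulVec, Matrix.one_mulVec, dotProduct_sub,
    hquad, smul_eq_mul]
  field_simp
  ring

end Algebra

/-! ### First and second derivatives of the asymptotic cost. -/

section Calculus

open scoped Matrix.Norms.Operator ContDiff

variable {m n p : ℕ}

/-- The evaluation of a matrix at an entry, as a continuous linear map. -/
noncomputable def entryCLM (i : Fin m) (j : Fin n) : Matrix (Fin m) (Fin n) ℝ →L[ℝ] ℝ :=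
  LinearMap.toContinuousLinearMap (Matrix.entryLinearMap ℝ ℝ i j)

@[simp] lemma entryCLM_apply (i : Fin m) (j : Fin n) (M : Matrix (Fin m) (Fin n) ℝ) :
    entryCLM i j M = M i j := rfl

lemma pderiv_eq_fderiv {f : (Fin p → ℝ) → ℝ} {x : Fin p → ℝ} (k : Fin p)
    (h : DifferentiableAt ℝ f x) : pderiv k f x = fderiv ℝ f x (Pi.single k 1) :=
  h.lineDeriv_eq_fderiv

lemma _root_.HasFDerivAt.pderiv_eq {f : (Fin p → ℝ) → ℝ} {f' : (Fin p → ℝ) →L[ℝ] ℝ}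
    {x : Fin p → ℝ} (h : HasFDerivAt f f' x) (k : Fin p) : pderiv k f x = f' (Pi.single k 1) := by
  rw [pderiv_eq_fderiv k h.differentiableAt, h.fderiv]

lemma pderiv_congr {f g : (Fin p → ℝ) → ℝ} {x : Fin p → ℝ} (k : Fin p) (h : f =ᶠ[𝓝 x] g) :
    pderiv k f x = pderiv k g x :=
  h.lineDeriv_eq

lemma mpderiv_eq_fderiv {M : (Fin p → ℝ) → Matrix (Fin m) (Fin n) ℝ} {x : Fin p → ℝ} (k : Fin p)
    (h : DifferentiableAt ℝ M x) : mpderiv k M x = fderiv ℝ M x (Pi.single k 1) := by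
  ext i j
  exact ((entryCLM i j).hasFDerivAt.comp x h.hasFDerivAt).pderiv_eq k

/-- Smoothness of `P` is assumed entry by entry; expanding in elementary matrices transfers it to
the matrix algebra with its operator norm, where inversion is smooth. -/
lemma contDiffAt_matrix {E : Type*} [NormedAddCommGroup E] [NormedSpace ℝ E] {r : WithTop ℕ∞}
    {M : E → Matrix (Fin m) (Fin n) ℝ} {x : E}
    (h : ∀ i j, ContDiffAt ℝ r (fun z => M z i j) x) : ContDiffAt ℝ r M x := by
  have : M = fun z => ∑ i, ∑ j, M z i j • Matrix.single i j (1 : ℝ) := by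
    funext z
    simpa using Matrix.matrix_eq_sum_single (M z)
  rw [this]
  exact ContDiffAt.sum fun i _ => ContDiffAt.sum fun j _ => (h i j).smul contDiffAt_const

lemma contDiffAt_matrix_inv {r : WithTop ℕ∞} {K : Matrix (Fin n) (Fin n) ℝ}
    (hK : IsUnit K.det) : ContDiffAt ℝ r (fun A : Matrix (Fin n) (Fin n) ℝ => A⁻¹) K := by
  obtain ⟨u, rfl⟩ := (Matrix.isUnit_iff_isUnit_det K).2 hK
  have := contDiffAt_ringInverse ℝ (n := r) u
  refine this.congr_of_eventuallyEq (Eventually.of_forall fun A => ?_)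
  exact Matrix.nonsing_inv_eq_ringInverse A

lemma hasFDerivAt_matrix_inv {K : Matrix (Fin n) (Fin n) ℝ} (hK : IsUnit K.det) :
    HasFDerivAt (fun A : Matrix (Fin n) (Fin n) ℝ => A⁻¹)
      (-ContinuousLinearMap.mulLeftRight ℝ (Matrix (Fin n) (Fin n) ℝ) K⁻¹ K⁻¹) K := by
  obtain ⟨u, rfl⟩ := (Matrix.isUnit_iff_isUnit_det K).2 hK
  have := hasFDerivAt_ringInverse (𝕜 := ℝ) u
  rw [Matrix.coe_units_inv] at this
  refine this.congr_of_eventuallyEq (Eventually.of_forall fun A => ?_)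
  exact Matrix.nonsing_inv_eq_ringInverse A

lemma contDiff_det {r : WithTop ℕ∞} :
    ContDiff ℝ r (fun A : Matrix (Fin n) (Fin n) ℝ => A.det) := by
  simp only [Matrix.det_apply]
  refine ContDiff.sum fun s _ => ContDiff.const_smul _ (contDiff_prod fun i _ => ?_)
  exact (entryCLM (s i) i).contDiff

/-- Jacobi's formula. -/
lemma fderiv_det {K : Matrix (Fin n) (Fin n) ℝ} (hK : IsUnit K.det)
    (X : Matrix (Fin n) (Fin n) ℝ) :
    fderiv ℝ (fun A : Matrix (Fin n) (Fin n) ℝ => A.det) K X = K.det * (K⁻¹ * X).trace := by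
  have hd : DifferentiableAt ℝ (fun A : Matrix (Fin n) (Fin n) ℝ => A.det) K :=
    (contDiff_det (r := 1)).contDiffAt.differentiableAt one_ne_zero
  refine hd.lineDeriv_eq_fderiv.symm.trans ?_
  rw [lineDeriv]
  -- After factoring out `K`, the determinant along the line is a polynomial in `t` whose linear
  -- coefficient is the trace; the rest is divisible by `t ^ 2` and does not affect the derivative
  -- at `0`.
  obtain ⟨q, hq⟩ : ∃ q : Polynomial ℝ, ∀ t : ℝ, (K + t • X).det =
      K.det * (1 + (K⁻¹ * X).trace * t + q.eval t * t ^ 2) := by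
    refine ⟨(Matrix.det (1 + (Polynomial.X : Polynomial ℝ) •
      (K⁻¹ * X).map Polynomial.C)).divX.divX, fun t => ?_⟩
    rw [← Matrix.det_one_add_smul, ← Matrix.det_mul, Matrix.mul_add, Matrix.mul_one,
      Matrix.mul_smul, ← Matrix.mul_assoc, Matrix.mul_nonsing_inv _ hK, Matrix.one_mul]
  simp only [hq]
  have h := ((((hasDerivAt_id (0 : ℝ)).const_mul (K⁻¹ * X).trace).const_add 1).add
    ((q.hasDerivAt 0).mul ((hasDerivAt_id (0 : ℝ)).pow 2))).const_mul K.det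
  simpa using h.deriv

section Curve

variable {E : Type*} [NormedAddCommGroup E] [NormedSpace ℝ E]
  {P : E → Matrix (Fin n) (Fin n) ℝ} {x : E}

lemma _root_.ContDiffAt.matrix_inv {r : WithTop ℕ∞} (h : ContDiffAt ℝ r P x)
    (hx : IsUnit (P x).det) : ContDiffAt ℝ r (fun z => (P z)⁻¹) x :=
  (contDiffAt_matrix_inv hx).comp x h

lemma _root_.DifferentiableAt.matrix_inv (h : DifferentiableAt ℝ P x) (hx : IsUnit (P x).det) :
    DifferentiableAt ℝ (fun z => (P z)⁻¹) x :=
  ((hasFDerivAt_matrix_inv hx).comp x h.hasFDerivAt).differentiableAt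

lemma fderiv_matrix_inv (h : DifferentiableAt ℝ P x) (hx : IsUnit (P x).det) (v : E) :
    fderiv ℝ (fun z => (P z)⁻¹) x v = -((P x)⁻¹ * fderiv ℝ P x v * (P x)⁻¹) := by
  refine (DFunLike.congr_fun ((hasFDerivAt_matrix_inv hx).comp x h.hasFDerivAt).fderiv v).trans ?_
  change (-ContinuousLinearMap.mulLeftRight ℝ (Matrix (Fin n) (Fin n) ℝ) (P x)⁻¹ (P x)⁻¹)
    (fderiv ℝ P x v) = _
  simp

lemma hasFDerivAt_log_det (h : DifferentiableAt ℝ P x) (hx : 0 < (P x).det) :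
    ∃ L : E →L[ℝ] ℝ, HasFDerivAt (fun z => Real.log (P z).det) L x ∧
      ∀ v, L v = ((P x)⁻¹ * fderiv ℝ P x v).trace := by
  have hd : HasFDerivAt (fun A : Matrix (Fin n) (Fin n) ℝ => A.det) _ (P x) :=
    ((contDiff_det (r := 1)).contDiffAt.differentiableAt one_ne_zero).hasFDerivAt
  refine ⟨_, (hd.comp x h.hasFDerivAt).log hx.ne', fun v => ?_⟩
  change (P x).det⁻¹ * fderiv ℝ (fun A : Matrix (Fin n) (Fin n) ℝ => A.det) (P x)
    (fderiv ℝ P x v) = _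
  rw [fderiv_det hx.ne'.isUnit, inv_mul_cancel_left₀ hx.ne']

end Curve

/-- The bilinear form of a matrix, as a continuous linear function of the matrix. -/
noncomputable def quadCLM (θ : Fin n → ℝ) : Matrix (Fin n) (Fin n) ℝ →L[ℝ] ℝ :=
  LinearMap.toContinuousLinearMap
    { toFun := fun K => θ ⬝ᵥ (K *ᵥ θ)
      map_add' := fun K L => by rw [Matrix.add_mulVec, dotProduct_add]
      map_smul' := fun c K => by rw [Matrix.smul_mulVec, dotProduct_smul]; rfl }

@[simp] lemma quadCLM_apply (θ : Fin n → ℝ) (K : Matrix (Fin n) (Fin n) ℝ) :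
    quadCLM θ K = θ ⬝ᵥ (K *ᵥ θ) := rfl

/-- The trace as a continuous linear map. -/
noncomputable def traceCLM : Matrix (Fin n) (Fin n) ℝ →L[ℝ] ℝ :=
  LinearMap.toContinuousLinearMap (Matrix.traceLinearMap (Fin n) ℝ ℝ)

@[simp] lemma traceCLM_apply (K : Matrix (Fin n) (Fin n) ℝ) : traceCLM K = K.trace := rfl

variable {α : ℝ} {P : (Fin p → ℝ) → Matrix (Fin n) (Fin n) ℝ} {θ : Fin n → ℝ} {η : Fin p → ℝ}

lemma hasFDerivAt_W (α : ℝ) (θ : Fin n → ℝ) (h : DifferentiableAt ℝ P η) (hx : 0 < (P η).det) :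
    ∃ L : (Fin p → ℝ) →L[ℝ] ℝ, HasFDerivAt (W α P θ) L η ∧
      ∀ v, L v = θ ⬝ᵥ (fderiv ℝ (fun z => (P z)⁻¹) η v *ᵥ θ)
        + α * ((P η)⁻¹ * fderiv ℝ P η v).trace := by
  obtain ⟨L, hL, hLv⟩ := hasFDerivAt_log_det h hx
  have h1 := (quadCLM θ).hasFDerivAt.comp η (h.matrix_inv hx.ne'.isUnit).hasFDerivAt
  refine ⟨_, h1.add (hL.const_mul α), fun v => ?_⟩
  change quadCLM θ (fderiv ℝ (fun z => (P z)⁻¹) η v) + α * L v = _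
  rw [hLv, quadCLM_apply]

lemma pderiv_W (α : ℝ) (θ : Fin n → ℝ) (h : DifferentiableAt ℝ P η) (hx : 0 < (P η).det)
    (k : Fin p) :
    pderiv k (W α P θ) η = θ ⬝ᵥ (mpderiv k (fun z => (P z)⁻¹) η *ᵥ θ)
        + α * ((P η)⁻¹ * mpderiv k P η).trace := by
  obtain ⟨L, hL, hLv⟩ := hasFDerivAt_W α θ h hx
  rw [hL.pderiv_eq, hLv, mpderiv_eq_fderiv k h,
    mpderiv_eq_fderiv k (h.matrix_inv hx.ne'.isUnit)]

lemma mpderiv_inv (h : DifferentiableAt ℝ P η) (hx : IsUnit (P η).det) (k : Fin p) :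
    mpderiv k (fun z => (P z)⁻¹) η = -((P η)⁻¹ * mpderiv k P η * (P η)⁻¹) := by
  rw [mpderiv_eq_fderiv k (h.matrix_inv hx), fderiv_matrix_inv h hx, mpderiv_eq_fderiv k h]

lemma contDiffAt_mpderiv {M : (Fin p → ℝ) → Matrix (Fin m) (Fin n) ℝ} (k : Fin p)
    (h : ContDiffAt ℝ 2 M η) : ContDiffAt ℝ 1 (mpderiv k M) η := by
  have h1 : ContDiffAt ℝ 1 (fun z => fderiv ℝ M z (Pi.single k 1)) η :=
    (h.fderiv_right (m := 1) (by norm_num)).clm_apply contDiffAt_const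
  refine h1.congr_of_eventuallyEq ?_
  filter_upwards [h.eventually (by simp)] with z hz
  exact mpderiv_eq_fderiv k (hz.differentiableAt (by simp))

lemma eventually_det_pos {X : Type*} [TopologicalSpace X] {P : X → Matrix (Fin n) (Fin n) ℝ}
    {x : X} (h : ContinuousAt P x) (hx : 0 < (P x).det) : ∀ᶠ z in 𝓝 x, 0 < (P z).det :=
  (Continuous.matrix_det continuous_id).continuousAt.comp h |>.eventually (lt_mem_nhds hx)

/-- The explicit matrix `A` is the Hessian of the asymptotic cost. -/
lemma hessian_W (α : ℝ) (θ : Fin n → ℝ) (h : ContDiffAt ℝ 2 P η) (hx : 0 < (P η).det) :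
    hessian (W α P θ) η = A α P θ η := by
  have hu := hx.ne'.isUnit
  have hinv : ContDiffAt ℝ 2 (fun z => (P z)⁻¹) η := h.matrix_inv hu
  ext k l
  simp only [hessian, A, Matrix.of_apply]
  have h1 : (fun z => pderiv l (W α P θ) z) =ᶠ[𝓝 η] fun z =>
      quadCLM θ (mpderiv l (fun z => (P z)⁻¹) z) + α * traceCLM ((P z)⁻¹ * mpderiv l P z) := by
    filter_upwards [h.eventually (by simp), eventually_det_pos h.continuousAt hx] with z hz hzx
    exact pderiv_W α θ (hz.differentiableAt (by simp)) hzx l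
  have hd1 := ((contDiffAt_mpderiv l hinv).differentiableAt one_ne_zero)
  have hd2 := ((contDiffAt_mpderiv l h).differentiableAt one_ne_zero)
  have hd3 := hinv.differentiableAt (by simp)
  have hd := ((quadCLM θ).hasFDerivAt.comp η hd1.hasFDerivAt).add
    ((traceCLM.hasFDerivAt.comp η (hd3.hasFDerivAt.mul' hd2.hasFDerivAt)).const_mul α)
  refine (pderiv_congr k h1).trans ((HasFDerivAt.pderiv_eq hd k).trans ?_)
  have e1 := mpderiv_eq_fderiv k hd1
  have e2 := mpderiv_eq_fderiv k hd2
  have e3 := mpderiv_eq_fderiv k hd3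
  have hP := h.differentiableAt (by simp)
  -- The product rule puts `k` on the inverse and `l` on `P`, whereas `A` has them the other way
  -- round. Both traces equal `-tr(P⁻¹ ∂ₖP P⁻¹ ∂ₗP)` by cyclicity.
  have hsymm : (mpderiv k (fun z => (P z)⁻¹) η * mpderiv l P η).trace =
      (mpderiv l (fun z => (P z)⁻¹) η * mpderiv k P η).trace := by
    rw [mpderiv_inv hP hu, mpderiv_inv hP hu, Matrix.neg_mul, Matrix.neg_mul, Matrix.trace_neg,
      Matrix.trace_neg, Matrix.mul_assoc _ (P η)⁻¹, Matrix.trace_mul_comm, Matrix.mul_assoc _ (P η)⁻¹]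
  rw [← hsymm]
  change quadCLM θ (fderiv ℝ (mpderiv l fun z => (P z)⁻¹) η (Pi.single k 1)) +
    α * traceCLM ((P η)⁻¹ * fderiv ℝ (mpderiv l P) η (Pi.single k 1) +
      fderiv ℝ (fun z => (P z)⁻¹) η (Pi.single k 1) * mpderiv l P η) = _
  rw [← e1, ← e2, ← e3, quadCLM_apply, traceCLM_apply, Matrix.trace_add]
  ring

/-- Along a coordinate line the form is an exact quadratic polynomial in `t`. Two terms appear
because `K` need not be symmetric. -/
lemma pderiv_quadratic (K : Matrix (Fin n) (Fin n) ℝ) (θ : Fin n → ℝ) (j : Fin n) :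
    pderiv j (fun θ => θ ⬝ᵥ (K *ᵥ θ)) θ = (K *ᵥ θ) j + (θ ᵥ* K) j := by
  have h1 : HasDerivAt (fun t : ℝ => (θ + t • Pi.single j (1 : ℝ)) ⬝ᵥ
      (K *ᵥ (θ + t • Pi.single j (1 : ℝ)))) ((K *ᵥ θ) j + (θ ᵥ* K) j) 0 := by
    have e : (fun t : ℝ => (θ + t • Pi.single j (1 : ℝ)) ⬝ᵥ
        (K *ᵥ (θ + t • Pi.single j (1 : ℝ)))) = fun t => θ ⬝ᵥ (K *ᵥ θ) +
          t * ((K *ᵥ θ) j + (θ ᵥ* K) j) + t ^ 2 * K j j := by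
      funext t
      simp only [Matrix.mulVec_add, Matrix.mulVec_smul, dotProduct_add, add_dotProduct,
        smul_dotProduct, dotProduct_smul, smul_eq_mul, single_one_dotProduct,
        Matrix.dotProduct_mulVec θ K (Pi.single j 1), dotProduct_single_one]
      simp
      ring
    rw [e]
    have := (((hasDerivAt_id (0 : ℝ)).mul_const ((K *ᵥ θ) j + (θ ᵥ* K) j)).const_add
      (θ ⬝ᵥ (K *ᵥ θ))).add (((hasDerivAt_id (0 : ℝ)).pow 2).mul_const (K j j))
    have h2 := this.congr_deriv (g' := (K *ᵥ θ) j + (θ ᵥ* K) j) (by simp)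
    exact h2.congr_of_eventuallyEq (Eventually.of_forall fun t => by simp)
  exact h1.deriv

/-- The explicit matrix `B` is the mixed derivative of the asymptotic cost. -/
lemma mixed_derivative_W (α : ℝ) (θ : Fin n → ℝ) (h : DifferentiableAt ℝ P η)
    (hx : IsUnit (P η).det) (hsymm : ∀ᶠ z in 𝓝 η, (P z).IsHermitian) :
    (Matrix.of fun (k : Fin p) (j : Fin n) =>
        pderiv k (fun z => pderiv j (fun θ => W α P θ z) θ) η) = B P θ η := by
  ext k j
  simp only [B, Matrix.of_apply]
  have h1 : (fun z => pderiv j (fun θ => W α P θ z) θ) =ᶠ[𝓝 η]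
      fun z => 2 * (θ ᵥ* (P z)⁻¹) j := by
    filter_upwards [hsymm] with z hz
    have hz' : ((P z)⁻¹)ᵀ = (P z)⁻¹ := by simpa using hz.inv.eq
    have : pderiv j (fun θ => W α P θ z) θ = pderiv j (fun θ => θ ⬝ᵥ ((P z)⁻¹ *ᵥ θ)) θ := by
      simp only [pderiv, lineDeriv, W, deriv_add_const]
    rw [this, pderiv_quadratic, ← Matrix.vecMul_transpose, hz']
    ring
  have h2 := h.matrix_inv hx
  let L : Matrix (Fin n) (Fin n) ℝ →L[ℝ] ℝ := LinearMap.toContinuousLinearMap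
    { toFun := fun K => 2 * (θ ᵥ* K) j
      map_add' := fun K L => by simp [Matrix.vecMul_add]; ring
      map_smul' := fun c K => by simp [Matrix.vecMul_smul]; ring }
  refine (pderiv_congr k h1).trans
    ((HasFDerivAt.pderiv_eq (L.hasFDerivAt.comp η h2.hasFDerivAt) k).trans ?_)
  rw [mpderiv_eq_fderiv k h2]
  rfl

end Calculus

/-! ### The minimizer as an implicit function of the perturbation. -/

section Implicit

open scoped Matrix.Norms.Operator ContDiff

variable {m n p : ℕ}

lemma _root_.ContDiffAt.matrix_apply {E : Type*} [NormedAddCommGroup E] [NormedSpace ℝ E]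
    {r : WithTop ℕ∞} {M : E → Matrix (Fin m) (Fin n) ℝ} {x : E} (h : ContDiffAt ℝ r M x)
    (i : Fin m) (j : Fin n) : ContDiffAt ℝ r (fun z => M z i j) x :=
  (entryCLM i j).contDiff.contDiffAt.comp x h

lemma _root_.ContDiffAt.matrix_mulVec {E : Type*} [NormedAddCommGroup E] [NormedSpace ℝ E]
    {r : WithTop ℕ∞} {M : E → Matrix (Fin m) (Fin n) ℝ} {v : E → Fin n → ℝ} {x : E}
    (hM : ContDiffAt ℝ r M x) (hv : ContDiffAt ℝ r v x) :
    ContDiffAt ℝ r (fun z => M z *ᵥ v z) x := by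
  rw [contDiffAt_pi] at hv ⊢
  intro i
  exact ContDiffAt.sum (s := Finset.univ) fun j _ => (hM.matrix_apply i j).mul (hv j)

lemma _root_.ContDiffAt.dotProduct {E : Type*} [NormedAddCommGroup E] [NormedSpace ℝ E]
    {r : WithTop ℕ∞} {v w : E → Fin n → ℝ} {x : E}
    (hv : ContDiffAt ℝ r v x) (hw : ContDiffAt ℝ r w x) :
    ContDiffAt ℝ r (fun z => v z ⬝ᵥ w z) x := by
  rw [contDiffAt_pi] at hv hw
  exact ContDiffAt.sum (s := Finset.univ) fun j _ => (hv j).mul (hw j)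

lemma clm_apply_eq_mulVec (L : (Fin p → ℝ) →L[ℝ] (Fin m → ℝ)) (w : Fin p → ℝ) :
    L w = (Matrix.of fun k l => L (Pi.single l 1) k) *ᵥ w := by
  have h := LinearMap.toMatrix'_mulVec L.toLinearMap w
  rw [ContinuousLinearMap.coe_coe] at h
  rw [← h]
  congr 1

/-- The gradient in `η` of `W` for the shifted kernel `P + M`, as a function of `((M, θ), η)`. -/
noncomputable def shiftedGradient (α : ℝ) (P : (Fin p → ℝ) → Matrix (Fin n) (Fin n) ℝ)
    (v : (Matrix (Fin n) (Fin n) ℝ × (Fin n → ℝ)) × (Fin p → ℝ)) : Fin p → ℝ := fun k =>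
  v.1.2 ⬝ᵥ (-((P v.2 + v.1.1)⁻¹ * mpderiv k P v.2 * (P v.2 + v.1.1)⁻¹) *ᵥ v.1.2)
    + α * ((P v.2 + v.1.1)⁻¹ * mpderiv k P v.2).trace

variable {α : ℝ} {P : (Fin p → ℝ) → Matrix (Fin n) (Fin n) ℝ} {θ : Fin n → ℝ} {η : Fin p → ℝ}
  {M : Matrix (Fin n) (Fin n) ℝ}

lemma mpderiv_add_const (k : Fin p) (M : Matrix (Fin n) (Fin n) ℝ) :
    mpderiv k (fun z => P z + M) η = mpderiv k P η := by
  ext i j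
  simp [mpderiv, pderiv, lineDeriv]

lemma pderiv_W_add (h : DifferentiableAt ℝ P η) (hx : 0 < (P η + M).det) (k : Fin p) :
    pderiv k (W α (fun z => P z + M) θ) η = shiftedGradient α P ((M, θ), η) k := by
  rw [pderiv_W α θ (h.add_const M) hx, mpderiv_inv (h.add_const M) hx.ne'.isUnit,
    mpderiv_add_const, shiftedGradient]

/-- Only first derivatives of `P` occur in the gradient, so `C²` regularity of `P` leaves exactly
the `C¹` regularity needed by the implicit function theorem. -/
lemma contDiffAt_shiftedGradient (h : ContDiffAt ℝ 2 P η) (hx : IsUnit (P η + M).det) :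
    ContDiffAt ℝ 1 (shiftedGradient α P) ((M, θ), η) := by
  rw [contDiffAt_pi]
  intro k
  have h1 : ContDiffAt ℝ 1 (fun v : (Matrix (Fin n) (Fin n) ℝ × (Fin n → ℝ)) × (Fin p → ℝ) =>
      P v.2 + v.1.1) ((M, θ), η) :=
    ((h.of_le (by norm_num)).comp ((M, θ), η) contDiffAt_snd).add
      (contDiffAt_fst.comp ((M, θ), η) contDiffAt_fst)
  have h2 := h1.matrix_inv hx
  have h3 : ContDiffAt ℝ 1 (fun v : (Matrix (Fin n) (Fin n) ℝ × (Fin n → ℝ)) × (Fin p → ℝ) =>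
      mpderiv k P v.2) ((M, θ), η) :=
    ContDiffAt.comp (g := mpderiv k P) ((M, θ), η) (contDiffAt_mpderiv k h) contDiffAt_snd
  have h4 : ContDiffAt ℝ 1 (fun v : (Matrix (Fin n) (Fin n) ℝ × (Fin n → ℝ)) × (Fin p → ℝ) =>
      v.1.2) ((M, θ), η) := contDiffAt_snd.comp ((M, θ), η) contDiffAt_fst
  exact (h4.dotProduct ((((h2.mul h3).mul h2).neg).matrix_mulVec h4)).add
    (contDiffAt_const.mul (traceCLM.contDiff.contDiffAt.comp _ (h2.mul h3)))

/-- The derivative of the gradient of `W`, in `θ` and `η`. -/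
lemma fderiv_shiftedGradient (h : ContDiffAt ℝ 2 P η) (hpos : (P η).PosDef)
    (hsymm : ∀ᶠ z in 𝓝 η, (P z).IsHermitian)
    (hHs : (hessian (W α P θ) η)ᵀ = hessian (W α P θ) η) (v : Fin n → ℝ) (w : Fin p → ℝ) :
    fderiv ℝ (shiftedGradient α P) ((0, θ), η) ((0, v), w) =
      B P θ η *ᵥ v + A α P θ η *ᵥ w := by
  have hx := hpos.det_pos
  have hu := hx.ne'.isUnit
  have hP := h.differentiableAt (by simp)
  have hf : HasFDerivAt (shiftedGradient α P) _ ((0, θ), η) :=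
    ((contDiffAt_shiftedGradient (α := α) (θ := θ) (M := 0) h (by simpa using hu)).differentiableAt
      one_ne_zero).hasFDerivAt
  set f' := fderiv ℝ (shiftedGradient α P) ((0, θ), η) with hf'
  have hη : f' ∘L ContinuousLinearMap.inr ℝ (Matrix (Fin n) (Fin n) ℝ × (Fin n → ℝ))
      (Fin p → ℝ) = LinearMap.toContinuousLinearMap (A α P θ η).mulVecLin := by
    ext w : 1
    rw [clm_apply_eq_mulVec, LinearMap.coe_toContinuousLinearMap', Matrix.mulVecLin_apply]
    congr 1
    -- The Jacobian of the gradient has entry `∂ₗ∂ₖW`, the transpose of the convention of `hessian`.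
    -- The symmetry used is the hypothesis `hHs`, later supplied by positive definiteness.
    rw [← hessian_W α θ h hx, ← hHs]
    ext k l
    have h1 := (hf.comp η ((hasFDerivAt_const ((0 : Matrix (Fin n) (Fin n) ℝ), θ) η).prodMk
      (hasFDerivAt_id η)))
    have h2 := (hasFDerivAt_pi'.1 h1 k).pderiv_eq l
    have h3 : (fun z => pderiv k (W α P θ) z) =ᶠ[𝓝 η]
        fun z => shiftedGradient α P ((0, θ), z) k := by
      filter_upwards [h.eventually (by simp), eventually_det_pos h.continuousAt hx] with z hz hzx
      rw [← pderiv_W_add (hz.differentiableAt (by simp)) (by simpa using hzx)]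
      simp only [add_zero]
    rw [Matrix.transpose_apply, hessian, Matrix.of_apply, Matrix.of_apply, pderiv_congr l h3]
    exact h2.symm
  have hθ : f' ∘L (ContinuousLinearMap.inl ℝ (Matrix (Fin n) (Fin n) ℝ × (Fin n → ℝ))
      (Fin p → ℝ) ∘L ContinuousLinearMap.inr ℝ (Matrix (Fin n) (Fin n) ℝ) (Fin n → ℝ)) =
      LinearMap.toContinuousLinearMap (B P θ η).mulVecLin := by
    ext v : 1
    rw [clm_apply_eq_mulVec, LinearMap.coe_toContinuousLinearMap', Matrix.mulVecLin_apply]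
    congr 1
    ext k j
    have h1 := (HasFDerivAt.comp (f := fun z => (((0 : Matrix (Fin n) (Fin n) ℝ), z), η)) θ hf (((hasFDerivAt_const (0 : Matrix (Fin n) (Fin n) ℝ) θ).prodMk
      (hasFDerivAt_id θ)).prodMk (hasFDerivAt_const η θ)))
    have h2 := (hasFDerivAt_pi'.1 h1 k).pderiv_eq j
    set K := mpderiv k (fun z => (P z)⁻¹) η with hK
    have h3 : (fun z => shiftedGradient α P ((0, z), η) k) =
        fun z => z ⬝ᵥ (K *ᵥ z) + α * ((P η)⁻¹ * mpderiv k P η).trace := by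
      funext z
      rw [hK, mpderiv_inv hP hu]
      simp only [shiftedGradient, add_zero]
    have h4 : pderiv j (fun z => shiftedGradient α P ((0, z), η) k) θ =
        pderiv j (fun z => z ⬝ᵥ (K *ᵥ z)) θ := by
      rw [h3]
      simp only [pderiv, lineDeriv, deriv_add_const]
    -- Symmetry of `P` near `η` makes the two terms of `pderiv_quadratic` equal, which produces the
    -- factor 2 in `B`.
    have hKt : Kᵀ = K := by
      ext i j
      change pderiv k (fun z => (P z)⁻¹ j i) η = pderiv k (fun z => (P z)⁻¹ i j) η
      refine pderiv_congr k (hsymm.mono fun z hz => ?_)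
      exact congrFun (congrFun (show ((P z)⁻¹)ᵀ = (P z)⁻¹ by simpa using hz.inv.eq) i) j
    have h5 := h4.symm.trans h2
    rw [pderiv_quadratic, ← Matrix.vecMul_transpose, hKt] at h5
    rw [Matrix.of_apply, B, Matrix.of_apply, Pi.smul_apply, smul_eq_mul, two_mul]
    exact h5.symm
  have hsplit : ((((0 : Matrix (Fin n) (Fin n) ℝ), v), w) :
      (Matrix (Fin n) (Fin n) ℝ × (Fin n → ℝ)) × (Fin p → ℝ)) = ((0, v), 0) + ((0, 0), w) := by
    simp
  rw [hsplit, map_add]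
  exact congrArg₂ (· + ·) (DFunLike.congr_fun hθ v) (DFunLike.congr_fun hη w)

/-- The stationary points of `W` near a nondegenerate one form a `C¹` function of the
perturbation `(M, θ)`. -/
lemma exists_stationary_function (h : ContDiffAt ℝ 2 P η) (hpos : (P η).PosDef)
    (hsymm : ∀ᶠ z in 𝓝 η, (P z).IsHermitian) (hH : (hessian (W α P θ) η).PosDef)
    (h0 : shiftedGradient α P ((0, θ), η) = 0) :
    ∃ ζ : Matrix (Fin n) (Fin n) ℝ × (Fin n → ℝ) → (Fin p → ℝ),
      ContDiffAt ℝ 1 ζ (0, θ) ∧ ζ (0, θ) = η ∧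
      (∀ v, fderiv ℝ ζ (0, θ) (0, v) = -((A α P θ η)⁻¹ * B P θ η) *ᵥ v) ∧
      ∀ᶠ v in 𝓝 (((0 : Matrix (Fin n) (Fin n) ℝ), θ), η),
        shiftedGradient α P v = 0 → ζ v.1 = v.2 := by
  have hu : IsUnit (P η).det := hpos.det_pos.ne'.isUnit
  have hf : ContDiffAt ℝ 1 (shiftedGradient α P) ((0, θ), η) :=
    contDiffAt_shiftedGradient h (by simpa using hu)
  have hHs : (hessian (W α P θ) η)ᵀ = hessian (W α P θ) η := by simpa using hH.isHermitian.eq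
  have hf' := fderiv_shiftedGradient h hpos hsymm hHs
  rw [hessian_W α θ h hpos.det_pos] at hH
  have hA : IsUnit (A α P θ η).det := hH.det_pos.ne'.isUnit
  set f' := fderiv ℝ (shiftedGradient α P) ((0, θ), η) with hf'def
  have hinr : ∀ w, (f' ∘L ContinuousLinearMap.inr ℝ (Matrix (Fin n) (Fin n) ℝ × (Fin n → ℝ))
      (Fin p → ℝ)) w = A α P θ η *ᵥ w := fun w => by
    refine (hf' 0 w).trans ?_
    rw [Matrix.mulVec_zero, zero_add]
  have hinv : (f' ∘L ContinuousLinearMap.inr ℝ (Matrix (Fin n) (Fin n) ℝ × (Fin n → ℝ))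
      (Fin p → ℝ)).IsInvertible := by
    refine ContinuousLinearMap.IsInvertible.of_inverse
      (g := LinearMap.toContinuousLinearMap ((A α P θ η)⁻¹).mulVecLin) ?_ ?_
    · ext w : 1
      refine (hinr _).trans ?_
      simp [Matrix.mulVec_mulVec, Matrix.mul_nonsing_inv _ hA]
    · ext w : 1
      refine (congrArg ((A α P θ η)⁻¹ *ᵥ ·) (hinr w)).trans ?_
      simp [Matrix.mulVec_mulVec, Matrix.nonsing_inv_mul _ hA]
  have hne : (1 : WithTop ℕ∞) ≠ 0 := one_ne_zero
  refine ⟨hf.implicitFunction hne hinv, hf.contDiffAt_implicitFunction hne hinv,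
    hf.implicitFunction_apply_self hne hinv, fun v => ?_, ?_⟩
  · have hζ := hf.hasStrictFDerivAt_implicitFunction hne hinv
    set ζ := hf.implicitFunction hne hinv
    have hζ0 : ζ (0, θ) = η := hf.implicitFunction_apply_self hne hinv
    -- Implicit differentiation: the gradient is constant along the branch, so `B v + A ζ'(0, v) =
    -- 0`. Only directions `(0, v)` matter, since `M` is deterministic for each `N`.
    have hcomp : HasFDerivAt (fun x => shiftedGradient α P (x, ζ x))
        (f' ∘L (ContinuousLinearMap.id ℝ _).prod (fderiv ℝ ζ (0, θ))) (0, θ) := by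
      refine HasFDerivAt.comp (g := shiftedGradient α P) (f := fun x => (x, ζ x)) (0, θ) ?_
        ((hasFDerivAt_id _).prodMk hζ.hasFDerivAt.differentiableAt.hasFDerivAt)
      rw [hζ0]
      exact (hf.differentiableAt hne).hasFDerivAt
    have hconst : (fun x => shiftedGradient α P (x, ζ x)) =ᶠ[𝓝 (0, θ)] fun _ => 0 := by
      filter_upwards [hf.eventually_apply_implicitFunction hne hinv] with x hx
      rw [hx, h0]
    have hz := hcomp.unique ((hasFDerivAt_const (0 : Fin p → ℝ) _).congr_of_eventuallyEq hconst)
    have hz' : f' ((0, v), fderiv ℝ ζ (0, θ) (0, v)) = 0 := DFunLike.congr_fun hz (0, v)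
    rw [hf'] at hz'
    have h1 := congrArg ((A α P θ η)⁻¹ *ᵥ ·) (eq_neg_of_add_eq_zero_right hz')
    simp only [Matrix.mulVec_mulVec, Matrix.nonsing_inv_mul _ hA, Matrix.one_mulVec,
      Matrix.mulVec_neg] at h1
    rw [h1, Matrix.neg_mulVec]
  · filter_upwards [hf.eventually_apply_eq_iff_implicitFunction hne hinv] with v hv hv0
    exact hv.1 (hv0.trans h0.symm)

variable {D : Set (Fin p → ℝ)} {ηstar : Fin p → ℝ}

lemma continuousAt_quad_add_log_det (α : ℝ) {K : Matrix (Fin n) (Fin n) ℝ} (hK : 0 < K.det)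
    (θ : Fin n → ℝ) :
    ContinuousAt (fun q : Matrix (Fin n) (Fin n) ℝ × (Fin n → ℝ) =>
      q.2 ⬝ᵥ (q.1⁻¹ *ᵥ q.2) + α * Real.log q.1.det) (K, θ) := by
  have h1 : ContDiffAt ℝ 1 (fun q : Matrix (Fin n) (Fin n) ℝ × (Fin n → ℝ) => q.1⁻¹) (K, θ) :=
    contDiffAt_fst.matrix_inv hK.ne'.isUnit
  have h2 : ContDiffAt ℝ 1 (fun q : Matrix (Fin n) (Fin n) ℝ × (Fin n → ℝ) => q.1.det) (K, θ) :=
    contDiff_det.contDiffAt.comp _ contDiffAt_fst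
  exact ((contDiffAt_snd.dotProduct (h1.matrix_mulVec contDiffAt_snd)).add
    (contDiffAt_const.mul (h2.log hK.ne'))).continuousAt

/-- Strict inequality at a single `y ≠ ηstar` persists for nearby `y` in `D` and small
perturbations; compactness of `D \ interior U` makes the allowed perturbation independent of `y`. -/
lemma eventually_W_lt_of_forall_lt (α : ℝ) (θ : Fin n → ℝ) (hD : IsCompact D)
    (hPpos : ∀ η ∈ D, (P η).PosDef) (hPcont : ContinuousOn P D) (hηD : ηstar ∈ D)
    (hmin : ∀ η ∈ D, η ≠ ηstar → W α P θ ηstar < W α P θ η)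
    {U : Set (Fin p → ℝ)} (hU : U ∈ 𝓝 ηstar) :
    ∀ᶠ x : Matrix (Fin n) (Fin n) ℝ × (Fin n → ℝ) in 𝓝 (0, θ), ∀ η ∈ D, η ∉ U →
      W α (fun z => P z + x.1) x.2 ηstar < W α (fun z => P z + x.1) x.2 η := by
  have hK : IsCompact (D \ interior U) := hD.diff isOpen_interior
  -- The repeated condition `η ∈ D` is deliberate: `P` is continuous only relative to `D`, so the
  -- local statement is an eventuality within `D`, turned into an implication.
  have key : ∀ᶠ x : Matrix (Fin n) (Fin n) ℝ × (Fin n → ℝ) in 𝓝 (0, θ), ∀ η ∈ D \ interior U,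
      η ∈ D → W α (fun z => P z + x.1) x.2 ηstar < W α (fun z => P z + x.1) x.2 η := by
    apply hK.eventually_forall_of_forall_eventually
    rintro y ⟨hyD, hyU⟩
    have hne : y ≠ ηstar := fun he => hyU (he ▸ mem_interior_iff_mem_nhds.2 hU)
    have hlim : ∀ g : (Matrix (Fin n) (Fin n) ℝ × (Fin n → ℝ)) × (Fin p → ℝ) → (Fin p → ℝ),
        ∀ a ∈ D, Tendsto (fun z => P (g z)) (𝓝[{z | z.2 ∈ D}] ((0, θ), y)) (𝓝 (P a)) →
        Tendsto (fun z => W α (fun w => P w + z.1.1) z.1.2 (g z))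
          (𝓝[{z | z.2 ∈ D}] ((0, θ), y)) (𝓝 (W α P θ a)) := by
      intro g a ha hg
      have h0 : Tendsto (fun z : (Matrix (Fin n) (Fin n) ℝ × (Fin n → ℝ)) × (Fin p → ℝ) => z.1.1)
          (𝓝[{z | z.2 ∈ D}] ((0, θ), y)) (𝓝 0) :=
        (continuous_fst.comp continuous_fst).continuousAt.tendsto.mono_left nhdsWithin_le_nhds
      have h1 : Tendsto (fun z : (Matrix (Fin n) (Fin n) ℝ × (Fin n → ℝ)) × (Fin p → ℝ) => z.1.2)
          (𝓝[{z | z.2 ∈ D}] ((0, θ), y)) (𝓝 θ) :=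
        (continuous_snd.comp continuous_fst).continuousAt.tendsto.mono_left nhdsWithin_le_nhds
      have h2 := hg.add h0
      rw [add_zero] at h2
      have h3 := h2.prodMk_nhds h1
      have h4 := (continuousAt_quad_add_log_det α (hPpos a ha).det_pos θ).tendsto.comp h3
      exact h4
    have hy : Tendsto (fun z : (Matrix (Fin n) (Fin n) ℝ × (Fin n → ℝ)) × (Fin p → ℝ) => P z.2)
        (𝓝[{z | z.2 ∈ D}] ((0, θ), y)) (𝓝 (P y)) := by
      refine (hPcont y hyD).tendsto.comp (tendsto_nhdsWithin_iff.2 ⟨?_, ?_⟩)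
      · exact continuous_snd.continuousAt.tendsto.mono_left nhdsWithin_le_nhds
      · exact eventually_mem_nhdsWithin
    have hlt := (hlim (fun _ => ηstar) ηstar hηD tendsto_const_nhds).eventually_lt
      (hlim Prod.snd y hyD hy) (hmin y hyD hne)
    exact eventually_nhdsWithin_iff.1 hlt
  filter_upwards [key] with x hx η hη hηU
  exact hx η ⟨hη, fun hi => hηU (interior_subset hi)⟩ hη

/-- Near `(0, θ)` the minimizer of the perturbed cost is a `C¹` function of the perturbation. -/
theorem exists_minimizer_function (hD : IsCompact D)
    (hPpos : ∀ η ∈ D, (P η).PosDef) (hPcont : ContinuousOn P D)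
    (hPsmooth : ∀ i j, ContDiffOn ℝ 2 (fun η => P η i j) (interior D))
    (hηint : ηstar ∈ interior D)
    (hηmin : ∀ η ∈ D, η ≠ ηstar → W α P θ ηstar < W α P θ η)
    (hηhess : (hessian (W α P θ) ηstar).PosDef) :
    ∃ ζ : Matrix (Fin n) (Fin n) ℝ × (Fin n → ℝ) → (Fin p → ℝ),
      ContDiffAt ℝ 1 ζ (0, θ) ∧ ζ (0, θ) = ηstar ∧
      (∀ v, fderiv ℝ ζ (0, θ) (0, v) = -((A α P θ ηstar)⁻¹ * B P θ ηstar) *ᵥ v) ∧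
      ∀ᶠ x : Matrix (Fin n) (Fin n) ℝ × (Fin n → ℝ) in 𝓝 (0, θ), ∀ η ∈ D,
        IsMinOn (W α (fun z => P z + x.1) x.2) D η → η = ζ x := by
  have hsm : ∀ η ∈ interior D, ContDiffAt ℝ 2 P η := fun η hη =>
    contDiffAt_matrix fun i j => (hPsmooth i j).contDiffAt (isOpen_interior.mem_nhds hη)
  have hstarD := interior_subset hηint
  have hnhds : ∀ᶠ z in 𝓝 ηstar, z ∈ interior D := isOpen_interior.mem_nhds hηint
  have stationary : ∀ (x : Matrix (Fin n) (Fin n) ℝ × (Fin n → ℝ)) (η : Fin p → ℝ),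
      η ∈ interior D → 0 < (P η + x.1).det → IsMinOn (W α (fun z => P z + x.1) x.2) D η →
      shiftedGradient α P (x, η) = 0 := by
    intro x η hη hx hmin
    have hP := (hsm η hη).differentiableAt (by simp)
    have hloc : IsLocalMin (W α (fun z => P z + x.1) x.2) η :=
      hmin.isLocalMin (mem_interior_iff_mem_nhds.1 hη)
    obtain ⟨L, hL, -⟩ := hasFDerivAt_W α x.2 (hP.add_const x.1) hx
    funext k
    rw [← pderiv_W_add hP hx, hL.pderiv_eq, hloc.hasFDerivAt_eq_zero hL]
    rfl
  have hmin0 : IsMinOn (W α (fun z => P z + (0 : Matrix (Fin n) (Fin n) ℝ)) θ) D ηstar := by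
    intro η hη
    change W α (fun z => P z + 0) θ ηstar ≤ W α (fun z => P z + 0) θ η
    simp only [add_zero]
    rcases eq_or_ne η ηstar with rfl | hne
    · exact le_rfl
    · exact le_of_lt (hηmin η hη hne)
  obtain ⟨ζ, hζ, hζ0, hζ', hloc⟩ := exists_stationary_function (hsm ηstar hηint)
    (hPpos ηstar hstarD) (hnhds.mono fun z hz => (hPpos z (interior_subset hz)).isHermitian)
    hηhess (stationary (0, θ) ηstar hηint (by simpa using (hPpos ηstar hstarD).det_pos) hmin0)
  refine ⟨ζ, hζ, hζ0, hζ', ?_⟩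
  have hdet : ∀ᶠ v : (Matrix (Fin n) (Fin n) ℝ × (Fin n → ℝ)) × (Fin p → ℝ) in
      𝓝 ((0, θ), ηstar), 0 < (P v.2 + v.1.1).det := by
    have hc : ContinuousAt (fun v : (Matrix (Fin n) (Fin n) ℝ × (Fin n → ℝ)) × (Fin p → ℝ) =>
        P v.2 + v.1.1) ((0, θ), ηstar) :=
      (ContinuousAt.comp (g := P) (hsm ηstar hηint).continuousAt continuousAt_snd).add
        (continuous_fst.comp continuous_fst).continuousAt
    exact eventually_det_pos hc (by simpa using (hPpos ηstar hstarD).det_pos)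
  have hint : ∀ᶠ v : (Matrix (Fin n) (Fin n) ℝ × (Fin n → ℝ)) × (Fin p → ℝ) in
      𝓝 ((0, θ), ηstar), v.2 ∈ interior D :=
    continuous_snd.continuousAt.eventually (p := fun z => z ∈ interior D) hnhds
  have hall := (hloc.and (hdet.and hint))
  -- A product neighbourhood yields a fixed neighbourhood `pb` of `ηstar` in which critical points
  -- lie on the branch; a minimizer outside `pb` would be beaten by `ηstar` itself.
  rw [nhds_prod_eq, eventually_prod_iff] at hall
  obtain ⟨pa, hpa, pb, hpb, hab⟩ := hall
  filter_upwards [hpa, eventually_W_lt_of_forall_lt α θ hD hPpos hPcont hstarD hηmin hpb]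
    with x hx hfar η hη hmin
  have hU : pb η := by
    by_contra hcon
    exact absurd (hmin hstarD) (not_le.2 (hfar η hη hcon))
  obtain ⟨h1, h2, h3⟩ := hab hx hU
  exact (h1 (stationary x η h3 h2 hmin)).symm

end Implicit

/-! ### First order expansion of the shrinkage term, uniform in the kernel perturbation. -/

section Expansion

open scoped Matrix.Norms.Operator ContDiff

variable {m n p : ℕ} {α : ℝ} {P : (Fin p → ℝ) → Matrix (Fin n) (Fin n) ℝ} {θ : Fin n → ℝ}
  {D : Set (Fin p → ℝ)} {ηstar : Fin p → ℝ}

lemma hasFDerivAt_mulVec {E : Type*} [NormedAddCommGroup E] [NormedSpace ℝ E]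
    {M : E → Matrix (Fin m) (Fin n) ℝ} {v : E → Fin n → ℝ} {x : E}
    {M' : E →L[ℝ] Matrix (Fin m) (Fin n) ℝ} {v' : E →L[ℝ] (Fin n → ℝ)}
    (hM : HasFDerivAt M M' x) (hv : HasFDerivAt v v' x) :
    ∃ L : E →L[ℝ] (Fin m → ℝ), HasFDerivAt (fun z => M z *ᵥ v z) L x ∧
      ∀ w, L w = M' w *ᵥ v x + M x *ᵥ v' w := by
  have hentry : ∀ i j, ∃ l : E →L[ℝ] ℝ, HasFDerivAt (fun z => M z i j) l x ∧
      ∀ w, l w = M' w i j :=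
    fun i j => ⟨_, (entryCLM i j).hasFDerivAt.comp x hM, fun w => rfl⟩
  choose l hl hlw using hentry
  have h : ∀ i, HasFDerivAt (fun z => ∑ j, M z i j * v z j) _ x := fun i =>
    HasFDerivAt.fun_sum fun j _ => (hl i j).mul (hasFDerivAt_pi'.1 hv j)
  refine ⟨_, hasFDerivAt_pi.2 h, fun w => ?_⟩
  ext i
  simp only [ContinuousLinearMap.coe_pi', _root_.sum_apply, Pi.add_apply, Matrix.mulVec,
    dotProduct, ← Finset.sum_add_distrib]
  refine Finset.sum_congr rfl fun j _ => ?_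
  simp [hlw]
  ring

/-- When the least squares estimate is far from `θ₀`, nothing is known of the hyper-parameter except
that it lies in `D`. This bound, uniform over `D` and over small `M`, then gives the linear growth
of the correction. -/
lemma exists_bound_inv_add (hD : IsCompact D) (hPpos : ∀ η ∈ D, (P η).PosDef)
    (hPcont : ContinuousOn P D) :
    ∃ C : ℝ, ∀ᶠ M in 𝓝 (0 : Matrix (Fin n) (Fin n) ℝ), ∀ η ∈ D,
      0 < (P η + M).det ∧ ∀ v, ‖(P η + M)⁻¹ *ᵥ v‖ ≤ C * ‖v‖ := by
  have hcont : ContinuousOn (fun η => (P η)⁻¹) D := fun η hη =>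
    ContinuousAt.comp_continuousWithinAt (g := fun K : Matrix (Fin n) (Fin n) ℝ => K⁻¹)
      (contDiffAt_matrix_inv (r := 1) (hPpos η hη).det_pos.ne'.isUnit).continuousAt (hPcont η hη)
  obtain ⟨C, hC⟩ := hD.exists_bound_of_continuousOn hcont
  refine ⟨C + 1, ?_⟩
  have key : ∀ᶠ M in 𝓝 (0 : Matrix (Fin n) (Fin n) ℝ), ∀ η ∈ D, η ∈ D →
      0 < (P η + M).det ∧ ‖(P η + M)⁻¹‖ < C + 1 := by
    apply hD.eventually_forall_of_forall_eventually
    intro y hy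
    have h0 : Tendsto (fun z : Matrix (Fin n) (Fin n) ℝ × (Fin p → ℝ) => P z.2 + z.1)
        (𝓝[{z | z.2 ∈ D}] (0, y)) (𝓝 (P y)) := by
      have h1 : Tendsto (fun z : Matrix (Fin n) (Fin n) ℝ × (Fin p → ℝ) => P z.2)
          (𝓝[{z | z.2 ∈ D}] (0, y)) (𝓝 (P y)) := by
        refine (hPcont y hy).tendsto.comp (tendsto_nhdsWithin_iff.2 ⟨?_, ?_⟩)
        · exact continuous_snd.continuousAt.tendsto.mono_left nhdsWithin_le_nhds
        · exact eventually_mem_nhdsWithin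
      have h2 : Tendsto (fun z : Matrix (Fin n) (Fin n) ℝ × (Fin p → ℝ) => z.1)
          (𝓝[{z | z.2 ∈ D}] (0, y)) (𝓝 0) :=
        continuous_fst.continuousAt.tendsto.mono_left nhdsWithin_le_nhds
      simpa using h1.add h2
    have hnorm : ContinuousAt (fun K : Matrix (Fin n) (Fin n) ℝ => ‖K⁻¹‖) (P y) :=
      (contDiffAt_matrix_inv (r := 1) (hPpos y hy).det_pos.ne'.isUnit).continuousAt.norm
    have h3 : ∀ᶠ K in 𝓝 (P y), 0 < K.det ∧ ‖K⁻¹‖ < C + 1 :=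
      (eventually_det_pos continuousAt_id (hPpos y hy).det_pos).and
        (hnorm.eventually (gt_mem_nhds (lt_of_le_of_lt (hC y hy) (lt_add_one C))))
    exact eventually_nhdsWithin_iff.1 (h0.eventually h3)
  filter_upwards [key] with M hM η hη
  refine ⟨(hM η hη hη).1, fun v => (Matrix.linfty_opNorm_mulVec _ v).trans ?_⟩
  exact mul_le_mul_of_nonneg_right (hM η hη hη).2.le (norm_nonneg v)

/-- Splitting a product neighbourhood gives a radius in `δ` that does not depend on `M`, hence one
valid for all large `N` at once. -/
lemma exists_radius_of_eventually {Y : Type*} [TopologicalSpace Y] {y : Y} {θ : Fin n → ℝ}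
    {q : Y × (Fin n → ℝ) → Prop} (h : ∀ᶠ x in 𝓝 (y, θ), q x) :
    ∃ r > 0, ∀ᶠ M in 𝓝 y, ∀ δ, ‖δ‖ ≤ r → q (M, θ + δ) := by
  rw [nhds_prod_eq, eventually_prod_iff] at h
  obtain ⟨pa, hpa, pb, hpb, hab⟩ := h
  obtain ⟨r, hr, hball⟩ := Metric.nhds_basis_closedBall.eventually_iff.1 hpb
  refine ⟨r, hr, hpa.mono fun M hM δ hδ => hab hM (hball ?_)⟩
  simpa using hδ

/-- The Jacobian in `η` of `P(η)⁻¹ θ`. -/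
noncomputable def kernelJacobian (P : (Fin p → ℝ) → Matrix (Fin n) (Fin n) ℝ) (θ : Fin n → ℝ)
    (η : Fin p → ℝ) : Matrix (Fin n) (Fin p) ℝ :=
  Matrix.of fun i k => (mpderiv k (fun z => (P z)⁻¹) η *ᵥ θ) i

lemma fderiv_inv_mulVec {η : Fin p → ℝ} (h : DifferentiableAt ℝ P η) (hu : IsUnit (P η).det)
    (w : Fin p → ℝ) :
    fderiv ℝ (fun z => (P z)⁻¹) η w *ᵥ θ = kernelJacobian P θ η *ᵥ w := by
  have h1 : w = ∑ k, w k • Pi.single k (1 : ℝ) := by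
    simpa using (pi_eq_sum_univ' w)
  have h2 := h.matrix_inv hu
  ext i
  conv_lhs => rw [h1, map_sum]
  simp only [map_smul, ← mpderiv_eq_fderiv _ h2, Matrix.sum_mulVec, Matrix.smul_mulVec,
    Finset.sum_apply, Pi.smul_apply, smul_eq_mul]
  simp only [kernelJacobian, Matrix.mulVec, dotProduct, Matrix.of_apply]
  exact Finset.sum_congr rfl fun k _ => mul_comm _ _

/-- First order expansion of `P(ζ)⁻¹ θ` for a hyper-parameter that depends on `(M, θ)`. -/
lemma hasStrictFDerivAt_shrinkage {ζ : Matrix (Fin n) (Fin n) ℝ × (Fin n → ℝ) → (Fin p → ℝ)}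
    {J : Matrix (Fin p) (Fin n) ℝ}
    (h : ContDiffAt ℝ 2 P ηstar) (hu : IsUnit (P ηstar).det)
    (hζ : ContDiffAt ℝ 1 ζ (0, θ)) (hζ0 : ζ (0, θ) = ηstar)
    (hζ' : ∀ v, fderiv ℝ ζ (0, θ) (0, v) = J *ᵥ v) :
    ∃ L : (Matrix (Fin n) (Fin n) ℝ × (Fin n → ℝ)) →L[ℝ] (Fin n → ℝ),
      HasStrictFDerivAt (fun x => (P (ζ x) + x.1)⁻¹ *ᵥ x.2) L (0, θ) ∧
      ∀ v, L (0, v) = ((P ηstar)⁻¹ + kernelJacobian P θ ηstar * J) *ᵥ v := by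
  subst hζ0
  have hP := h.differentiableAt (by simp)
  have hQ : ContDiffAt ℝ 1 (fun x : Matrix (Fin n) (Fin n) ℝ × (Fin n → ℝ) => P (ζ x) + x.1)
      (0, θ) :=
    ((h.of_le (by norm_num)).comp (0, θ) hζ).add contDiffAt_fst
  have hQu : IsUnit (P (ζ (0, θ)) + (0 : Matrix (Fin n) (Fin n) ℝ)).det := by simpa using hu
  have hH : ContDiffAt ℝ 1 (fun x : Matrix (Fin n) (Fin n) ℝ × (Fin n → ℝ) =>
      (P (ζ x) + x.1)⁻¹ *ᵥ x.2) (0, θ) := (hQ.matrix_inv hQu).matrix_mulVec contDiffAt_snd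
  have hQ' : HasFDerivAt (fun x : Matrix (Fin n) (Fin n) ℝ × (Fin n → ℝ) => P (ζ x) + x.1)
      (fderiv ℝ P (ζ (0, θ)) ∘L fderiv ℝ ζ (0, θ) + ContinuousLinearMap.fst ℝ _ _) (0, θ) :=
    (HasFDerivAt.comp (g := P) (0, θ) hP.hasFDerivAt
      (hζ.differentiableAt one_ne_zero).hasFDerivAt).add hasFDerivAt_fst
  obtain ⟨L, hL, hLv⟩ := hasFDerivAt_mulVec
    ((hQ.matrix_inv hQu).differentiableAt one_ne_zero).hasFDerivAt
    (hasFDerivAt_snd (𝕜 := ℝ) (p := ((0 : Matrix (Fin n) (Fin n) ℝ), θ)))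
  refine ⟨L, ?_, fun v => ?_⟩
  -- `C¹` regularity upgrades the derivative to a strict one, as the expansion will be taken around
  -- the moving base points `(M, θ)`.
  · exact hH.hasStrictFDerivAt' hL one_ne_zero
  · have e1 : fderiv ℝ (fun x : Matrix (Fin n) (Fin n) ℝ × (Fin n → ℝ) => P (ζ x) + x.1)
        (0, θ) (0, v) = fderiv ℝ P (ζ (0, θ)) (J *ᵥ v) := by
      rw [← hζ' v]
      exact (DFunLike.congr_fun hQ'.fderiv (0, v)).trans (add_zero _)
    have e2 : fderiv ℝ (fun x : Matrix (Fin n) (Fin n) ℝ × (Fin n → ℝ) => (P (ζ x) + x.1)⁻¹)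
        (0, θ) (0, v) = fderiv ℝ (fun z => (P z)⁻¹) (ζ (0, θ)) (J *ᵥ v) := by
      refine (fderiv_matrix_inv hQ'.differentiableAt hQu _).trans
        (Eq.trans ?_ (fderiv_matrix_inv hP hu _).symm)
      refine (congrArg (fun K => -((P (ζ (0, θ)) + (0 : Matrix (Fin n) (Fin n) ℝ))⁻¹ * K *
        (P (ζ (0, θ)) + (0 : Matrix (Fin n) (Fin n) ℝ))⁻¹)) e1).trans ?_
      simp only [add_zero]
    refine (hLv (0, v)).trans ((congrArg
      (fun K => K *ᵥ θ + (P (ζ (0, θ)) + (0 : Matrix (Fin n) (Fin n) ℝ))⁻¹ *ᵥ v) e2).trans ?_)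
    rw [add_zero, fderiv_inv_mulVec hP hu, Matrix.add_mulVec, ← Matrix.mulVec_mulVec, add_comm]

/-- Joint `C¹` regularity at `(0, θ)` makes each slice with `M` near `0` differentiable at `θ`, with
Jacobian continuous in `M` at `0`. -/
lemma tendsto_jacobian_section {ζ : Matrix (Fin n) (Fin n) ℝ × (Fin n → ℝ) → (Fin p → ℝ)}
    {J : Matrix (Fin p) (Fin n) ℝ} (hζ : ContDiffAt ℝ 1 ζ (0, θ))
    (hζ' : ∀ v, fderiv ℝ ζ (0, θ) (0, v) = J *ᵥ v) :
    (∀ᶠ M in 𝓝 (0 : Matrix (Fin n) (Fin n) ℝ), DifferentiableAt ℝ (fun z => ζ (M, z)) θ) ∧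
    Tendsto (fun M => jacobian (fun z => ζ (M, z)) θ) (𝓝 0) (𝓝 J) := by
  have hslice : Tendsto (fun M : Matrix (Fin n) (Fin n) ℝ => (M, θ)) (𝓝 0) (𝓝 (0, θ)) :=
    (Continuous.prodMk_left θ).continuousAt.tendsto
  have hev : ∀ᶠ M in 𝓝 (0 : Matrix (Fin n) (Fin n) ℝ), DifferentiableAt ℝ ζ (M, θ) :=
    (hslice.eventually (hζ.eventually (by simp))).mono fun M hM => hM.differentiableAt one_ne_zero
  have hder : ∀ᶠ M in 𝓝 (0 : Matrix (Fin n) (Fin n) ℝ), HasFDerivAt (fun z => ζ (M, z))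
      (fderiv ℝ ζ (M, θ) ∘L ContinuousLinearMap.inr ℝ _ _) θ := by
    filter_upwards [hev] with M hM
    exact HasFDerivAt.comp (f := fun z => (M, z)) θ hM.hasFDerivAt (hasFDerivAt_prodMk_right M θ)
  refine ⟨hder.mono fun M hM => hM.differentiableAt, ?_⟩
  refine tendsto_pi_nhds.2 fun i => tendsto_pi_nhds.2 fun j => ?_
  have hJ : J i j = fderiv ℝ ζ (0, θ) (0, Pi.single j 1) i := by
    rw [hζ']
    simp
  rw [hJ]
  have hc : ContinuousAt (fun x => fderiv ℝ ζ x (0, Pi.single j 1) i) (0, θ) :=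
    (continuous_apply i).continuousAt.comp
      (((hζ.fderiv_right (m := 0) (by norm_num)).clm_apply contDiffAt_const).continuousAt)
  refine (hc.tendsto.comp hslice).congr' ?_
  filter_upwards [hder] with M hM
  exact ((hasFDerivAt_pi'.1 hM i).pderiv_eq j).symm

end Expansion

section Expansion

open scoped Matrix.Norms.Operator ContDiff

variable {n : ℕ} {θ : Fin n → ℝ}

/-- A strict derivative compares the two nearby points `(M, θ + δ)` and `(M, θ)` directly, with
error `ε‖δ‖`. An ordinary derivative at `(0, θ)` would leave an error involving `‖M‖`, not
controlled by `‖δ‖`. -/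
lemma exists_radius_of_hasStrictFDerivAt
    {H : Matrix (Fin n) (Fin n) ℝ × (Fin n → ℝ) → (Fin n → ℝ)}
    {L : (Matrix (Fin n) (Fin n) ℝ × (Fin n → ℝ)) →L[ℝ] (Fin n → ℝ)}
    {J : Matrix (Fin n) (Fin n) ℝ} (hH : HasStrictFDerivAt H L (0, θ))
    (hL : ∀ v, L (0, v) = J *ᵥ v) {ε : ℝ} (hε : 0 < ε) :
    ∃ r > 0, ∀ᶠ M in 𝓝 (0 : Matrix (Fin n) (Fin n) ℝ), ∀ δ, ‖δ‖ ≤ r →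
      ‖H (M, θ + δ) - H (M, θ) - J *ᵥ δ‖ ≤ ε * ‖δ‖ := by
  have h1 := hH.isLittleO.def hε
  have h2 : Tendsto (fun x : Matrix (Fin n) (Fin n) ℝ × (Fin n → ℝ) => (x, (x.1, θ)))
      (𝓝 (0, θ)) (𝓝 ((0, θ), (0, θ))) :=
    (continuous_id.prodMk (continuous_fst.prodMk continuous_const)).continuousAt.tendsto
  obtain ⟨r, hr, h⟩ := exists_radius_of_eventually (h2.eventually h1)
  refine ⟨r, hr, h.mono fun M hM δ hδ => ?_⟩
  have h3 := hM δ hδ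
  have e : ((M, θ + δ) : Matrix (Fin n) (Fin n) ℝ × (Fin n → ℝ)) - (M, θ) = (0, δ) := by
    ext <;> simp
  have e2 : ‖((0, δ) : Matrix (Fin n) (Fin n) ℝ × (Fin n → ℝ))‖ = ‖δ‖ := by
    simp [Prod.norm_def]
  rw [← hL, ← e2, ← e]
  exact h3

lemma tendsto_of_hasStrictFDerivAt
    {H : Matrix (Fin n) (Fin n) ℝ × (Fin n → ℝ) → (Fin n → ℝ)}
    {L : (Matrix (Fin n) (Fin n) ℝ × (Fin n → ℝ)) →L[ℝ] (Fin n → ℝ)}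
    (hH : HasStrictFDerivAt H L (0, θ)) :
    Tendsto (fun M => H (M, θ)) (𝓝 0) (𝓝 (H (0, θ))) :=
  hH.continuousAt.tendsto.comp (Continuous.prodMk_left θ).continuousAt.tendsto

lemma tendsto_of_contDiffAt {p : ℕ} {ζ : Matrix (Fin n) (Fin n) ℝ × (Fin n → ℝ) → (Fin p → ℝ)}
    (hζ : ContDiffAt ℝ 1 ζ (0, θ)) : Tendsto (fun M => ζ (M, θ)) (𝓝 0) (𝓝 (ζ (0, θ))) :=
  hζ.continuousAt.tendsto.comp (Continuous.prodMk_left θ).continuousAt.tendsto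

end Expansion

variable {n p : ℕ} {α : ℝ} {P : (Fin p → ℝ) → Matrix (Fin n) (Fin n) ℝ} {θ : Fin n → ℝ}
  {D : Set (Fin p → ℝ)} {ηstar : Fin p → ℝ}

/-- The hyper-parameter as a function of the perturbation `M = σ² (ΦᵀΦ)⁻¹` of the kernel and of the
maximum likelihood estimate, with its first order behaviour near `(0, θ)`. -/
theorem exists_hyperparameter_map (hD : IsCompact D)
    (hPpos : ∀ η ∈ D, (P η).PosDef) (hPcont : ContinuousOn P D)
    (hPsmooth : ∀ i j, ContDiffOn ℝ 2 (fun η => P η i j) (interior D))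
    (hηint : ηstar ∈ interior D)
    (hηmin : ∀ η ∈ D, η ≠ ηstar → W α P θ ηstar < W α P θ η)
    (hηhess : (hessian (W α P θ) ηstar).PosDef) :
    ∃ ζ : Matrix (Fin n) (Fin n) ℝ → (Fin n → ℝ) → (Fin p → ℝ),
      (∃ r > 0, ∀ᶠ M in 𝓝 (0 : Matrix (Fin n) (Fin n) ℝ), ∀ δ, ‖δ‖ ≤ r → ∀ η ∈ D,
        IsMinOn (W α (fun z => P z + M) (θ + δ)) D η → η = ζ M (θ + δ)) ∧
      Tendsto (fun M => ζ M θ) (𝓝 0) (𝓝 ηstar) ∧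
      (∀ᶠ M in 𝓝 (0 : Matrix (Fin n) (Fin n) ℝ), DifferentiableAt ℝ (ζ M) θ) ∧
      Tendsto (fun M => jacobian (ζ M) θ) (𝓝 0) (𝓝 (-((A α P θ ηstar)⁻¹ * B P θ ηstar))) ∧
      Tendsto (fun M => (P (ζ M θ) + M)⁻¹ *ᵥ θ) (𝓝 0) (𝓝 ((P ηstar)⁻¹ *ᵥ θ)) ∧
      ∀ ε > 0, ∃ r > 0, ∀ᶠ M in 𝓝 (0 : Matrix (Fin n) (Fin n) ℝ), ∀ δ, ‖δ‖ ≤ r →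
        ‖(P (ζ M (θ + δ)) + M)⁻¹ *ᵥ (θ + δ) - (P (ζ M θ) + M)⁻¹ *ᵥ θ -
          ((P ηstar)⁻¹ + kernelJacobian P θ ηstar * -((A α P θ ηstar)⁻¹ * B P θ ηstar)) *ᵥ δ‖
          ≤ ε * ‖δ‖ := by
  obtain ⟨ζ, hζ, hζ0, hζ', hmin⟩ :=
    exists_minimizer_function hD hPpos hPcont hPsmooth hηint hηmin hηhess
  have hu : IsUnit (P ηstar).det := (hPpos ηstar (interior_subset hηint)).det_pos.ne'.isUnit
  obtain ⟨L, hL, hLv⟩ := hasStrictFDerivAt_shrinkage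
    (contDiffAt_matrix fun i j => (hPsmooth i j).contDiffAt (isOpen_interior.mem_nhds hηint))
    hu hζ hζ0 hζ'
  obtain ⟨hdiff, hjac⟩ := tendsto_jacobian_section hζ hζ'
  refine ⟨fun M z => ζ (M, z), exists_radius_of_eventually hmin, ?_, hdiff, hjac, ?_,
    fun ε hε => exists_radius_of_hasStrictFDerivAt hL hLv hε⟩
  · have := tendsto_of_contDiffAt hζ
    rw [hζ0] at this
    exact this
  · have := tendsto_of_hasStrictFDerivAt hL
    simp only [hζ0, add_zero] at this
    exact this

/-! ### Moments of linear forms in the noise. -/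

section Gaussian

open scoped NNReal ENNReal

instance (N : ℕ) (σ : ℝ) : IsProbabilityMeasure (noise N σ) := by
  unfold noise
  infer_instance

variable {N : ℕ} {σ : ℝ}

lemma hasGaussianLaw_dotProduct (σ : ℝ) (a : Fin N → ℝ) :
    HasGaussianLaw (fun e => a ⬝ᵥ e) (noise N σ) := by
  have h1 : ∀ i, HasGaussianLaw (fun e : Fin N → ℝ => a i * e i) (noise N σ) := fun i => by
    have h := ((measurePreserving_eval
      (fun _ : Fin N => gaussianReal 0 (Real.toNNReal (σ ^ 2))) i).hasLaw).hasGaussianLaw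
    exact h.fun_smul (a i)
  have h2 : iIndepFun (fun i (e : Fin N → ℝ) => a i * e i) (noise N σ) :=
    iIndepFun_pi (X := fun i x => a i * x) fun i => (measurable_const_mul (a i)).aemeasurable
  exact iIndepFun.hasGaussianLaw_fun_sum h1 h2

lemma integral_dotProduct_noise (a : Fin N → ℝ) : ∫ e, a ⬝ᵥ e ∂(noise N σ) = 0 := by
  simp only [dotProduct]
  rw [integral_finsetSum]
  · simp [noise, integral_const_mul, integral_eval, integral_id_gaussianReal]
  · intro i _
    exact (integrable_eval IsGaussian.integrable_id).const_mul _

lemma variance_dotProduct_noise (a : Fin N → ℝ) :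
    Var[fun e => a ⬝ᵥ e; noise N σ] = σ ^ 2 * (a ⬝ᵥ a) := by
  have h : (fun e : Fin N → ℝ => a ⬝ᵥ e) = ∑ i, fun e : Fin N → ℝ => a i * e i := by
    ext e
    simp [dotProduct]
  rw [h, noise, variance_sum_pi (X := fun i x => a i * x)]
  · change ∑ i, Var[fun x ↦ _ * (id x); gaussianReal 0 _] = _
    simp_rw [variance_const_mul, variance_id_gaussianReal, Real.coe_toNNReal _ (sq_nonneg σ),
      dotProduct, Finset.mul_sum]
    exact Finset.sum_congr rfl fun i _ => by ring
  · exact fun i ↦ IsGaussian.memLp_two_id.const_mul _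

lemma map_dotProduct_noise (a : Fin N → ℝ) :
    (noise N σ).map (fun e => a ⬝ᵥ e) = gaussianReal 0 (Real.toNNReal (σ ^ 2 * (a ⬝ᵥ a))) := by
  rw [(hasGaussianLaw_dotProduct σ a).map_eq_gaussianReal, integral_dotProduct_noise,
    variance_dotProduct_noise]

lemma memLp_dotProduct_noise (a : Fin N → ℝ) {q : ℝ≥0∞} (hq : q ≠ ∞) :
    MemLp (fun e => a ⬝ᵥ e) q (noise N σ) :=
  (hasGaussianLaw_dotProduct σ a).memLp hq

lemma integral_sq_dotProduct_noise (a : Fin N → ℝ) :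
    ∫ e, (a ⬝ᵥ e) ^ 2 ∂(noise N σ) = σ ^ 2 * (a ⬝ᵥ a) := by
  rw [← variance_dotProduct_noise, variance_of_integral_eq_zero
    (memLp_dotProduct_noise a (q := 2) (by simp)).aestronglyMeasurable.aemeasurable
    (integral_dotProduct_noise a)]

lemma integral_dotProduct_mul_dotProduct_noise (a b : Fin N → ℝ) :
    ∫ e, (a ⬝ᵥ e) * (b ⬝ᵥ e) ∂(noise N σ) = σ ^ 2 * (a ⬝ᵥ b) := by
  have hi : ∀ c : Fin N → ℝ, Integrable (fun e => (c ⬝ᵥ e) ^ 2) (noise N σ) := fun c =>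
    (memLp_dotProduct_noise c (q := 2) (by simp)).integrable_sq
  -- Polarization reduces the covariance to three variances.
  have h : ∀ e : Fin N → ℝ, (a ⬝ᵥ e) * (b ⬝ᵥ e) =
      (1 / 2) * (((a + b) ⬝ᵥ e) ^ 2 - (a ⬝ᵥ e) ^ 2 - (b ⬝ᵥ e) ^ 2) := fun e => by
    rw [add_dotProduct]
    ring
  have h' : Integrable (fun e => ((a + b) ⬝ᵥ e) ^ 2 - (a ⬝ᵥ e) ^ 2) (noise N σ) :=
    (hi _).sub (hi _)
  simp_rw [h]
  rw [integral_const_mul, integral_sub h' (hi _), integral_sub (hi _) (hi _),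
    integral_sq_dotProduct_noise, integral_sq_dotProduct_noise, integral_sq_dotProduct_noise,
    add_dotProduct, dotProduct_add, dotProduct_add, dotProduct_comm b a]
  ring

/-- Scaling by `√v`. The standard fourth moment stays unevaluated, since only the order `v²`
matters. -/
lemma integral_pow_four_gaussianReal (v : ℝ≥0) :
    ∫ x, x ^ 4 ∂(gaussianReal 0 v) = (v : ℝ) ^ 2 * ∫ x, x ^ 4 ∂(gaussianReal 0 1) := by
  have h := gaussianReal_map_const_mul (μ := 0) (v := 1) (Real.sqrt v)
  have hv : NNReal.mk (Real.sqrt v ^ 2) (sq_nonneg _) * 1 = v := by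
    ext
    simp
  rw [hv, mul_zero] at h
  rw [← h, integral_map (measurable_const_mul _).aemeasurable (by fun_prop)]
  simp_rw [mul_pow]
  rw [integral_const_mul]
  congr 1
  rw [show (4 : ℕ) = 2 * 2 from rfl, pow_mul, Real.sq_sqrt v.coe_nonneg]

lemma integral_pow_four_dotProduct_noise (a : Fin N → ℝ) :
    ∫ e, (a ⬝ᵥ e) ^ 4 ∂(noise N σ) =
      (σ ^ 2 * (a ⬝ᵥ a)) ^ 2 * ∫ x, x ^ 4 ∂(gaussianReal 0 1) := by
  have hnn : 0 ≤ σ ^ 2 * (a ⬝ᵥ a) :=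
    mul_nonneg (sq_nonneg σ) (Finset.sum_nonneg fun i _ => mul_self_nonneg _)
  have h := integral_map (μ := noise N σ) (φ := fun e => a ⬝ᵥ e) (f := fun x : ℝ => x ^ 4)
    (memLp_dotProduct_noise a (q := 2) (by simp)).aestronglyMeasurable.aemeasurable (by fun_prop)
  rw [← h, map_dotProduct_noise, integral_pow_four_gaussianReal, Real.coe_toNNReal _ hnn]

end Gaussian

/-! ### Moment asymptotics from a uniform first order expansion. -/

section Asymptotics

variable {n : ℕ} {Ω : ℕ → Type*} {δ : ∀ N, Ω N → Fin n → ℝ} {G : ∀ N, Ω N → ℝ}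
  {g : ℕ → ℝ} {l : ℕ → Fin n → ℝ} {gLim : ℝ} {lLim : Fin n → ℝ}

lemma norm_pow_le_sum (x : Fin n → ℝ) {k : ℕ} (hk : k ≠ 0) : ‖x‖ ^ k ≤ ∑ j, |x j| ^ k := by
  rcases isEmpty_or_nonempty (Fin n) with hn | hn
  · simp [Subsingleton.elim x 0, hk]
  · obtain ⟨i, -, hi⟩ := Finset.exists_max_image Finset.univ (fun j => ‖x j‖) Finset.univ_nonempty
    have h1 : ‖x‖ ≤ ‖x i‖ := (pi_norm_le_iff_of_nonneg (norm_nonneg _)).2 fun j =>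
      hi j (Finset.mem_univ j)
    calc ‖x‖ ^ k ≤ |x i| ^ k := pow_le_pow_left₀ (norm_nonneg _) h1 k
      _ ≤ _ := Finset.single_le_sum (f := fun j => |x j| ^ k)
        (fun j _ => pow_nonneg (abs_nonneg _) k) (Finset.mem_univ i)

lemma abs_dotProduct_le (l x : Fin n → ℝ) : |l ⬝ᵥ x| ≤ n * ‖l‖ * ‖x‖ := by
  calc |l ⬝ᵥ x| ≤ ∑ j, |l j * x j| := Finset.abs_sum_le_sum_abs _ _
    _ ≤ ∑ _j : Fin n, ‖l‖ * ‖x‖ := Finset.sum_le_sum fun j _ => by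
        rw [abs_mul]
        exact mul_le_mul (norm_le_pi_norm l j) (norm_le_pi_norm x j) (abs_nonneg _) (norm_nonneg _)
    _ = n * ‖l‖ * ‖x‖ := by simp [mul_assoc]

lemma exists_eventually_norm_le {E : Type*} [NormedAddCommGroup E] {f : ℕ → E} {a : E}
    (h : Tendsto f atTop (𝓝 a)) : ∃ K, 0 ≤ K ∧ ∀ᶠ N in atTop, ‖f N‖ ≤ K :=
  ⟨‖a‖ + 1, by positivity, (h.norm.eventually (gt_mem_nhds (lt_add_one _))).mono fun _ hN => hN.le⟩

/-- A uniform first order expansion and linear growth give a global bound of the remainder. -/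
lemma exists_remainder_bound (hg : Tendsto g atTop (𝓝 gLim)) (hl : Tendsto l atTop (𝓝 lLim))
    (hgrow : ∃ K, ∀ᶠ N in atTop, ∀ e, |G N e| ≤ K * (1 + ‖δ N e‖))
    (hlin : ∀ ε > 0, ∃ r > 0, ∀ᶠ N in atTop, ∀ e, ‖δ N e‖ ≤ r →
      |G N e - g N - l N ⬝ᵥ δ N e| ≤ ε * ‖δ N e‖) {ε : ℝ} (hε : 0 < ε) :
    ∃ K, 0 ≤ K ∧ ∀ᶠ N in atTop, ∀ e,
      |G N e - g N - l N ⬝ᵥ δ N e| ≤ ε * ‖δ N e‖ + K * ‖δ N e‖ ^ 3 := by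
  obtain ⟨K₀, hK₀⟩ := hgrow
  obtain ⟨Kg, hKg0, hKg⟩ := exists_eventually_norm_le hg
  obtain ⟨Kl, hKl0, hKl⟩ := exists_eventually_norm_le hl
  obtain ⟨r, hr, hlin⟩ := hlin ε hε
  set K₁ := |K₀| + Kg + n * Kl with hK₁
  have hK₁0 : 0 ≤ K₁ := by positivity
  -- For `d > r` one has `1 ≤ d³/r³` and `d ≤ d³/r²`, so the linear bound `K₁ (1 + d)` is at most
  -- this constant times `d³`. The cube becomes a fourth power after multiplication by a coordinate
  -- of `δ`.
  refine ⟨K₁ * ((r ^ 3)⁻¹ + (r ^ 2)⁻¹), by positivity, ?_⟩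
  filter_upwards [hK₀, hKg, hKl, hlin] with N h1 h2 h3 h4 e
  set d := ‖δ N e‖ with hd
  have hd0 : 0 ≤ d := norm_nonneg _
  rcases le_or_gt d r with hdr | hdr
  · exact (h4 e hdr).trans (le_add_of_nonneg_right (by positivity))
  · have h5 : |l N ⬝ᵥ δ N e| ≤ n * Kl * d := (abs_dotProduct_le _ _).trans (by gcongr)
    have h6 : |G N e| ≤ |K₀| * (1 + d) := (h1 e).trans (by gcongr; exact le_abs_self _)
    have h7 : |G N e - g N - l N ⬝ᵥ δ N e| ≤ K₁ * (1 + d) := by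
      have h8 := (abs_sub (G N e - g N) (l N ⬝ᵥ δ N e)).trans
        (add_le_add_left (abs_sub (G N e) (g N)) _)
      have h9 : |g N| ≤ Kg := h2
      have h10 : 0 ≤ Kg * d := by positivity
      have h11 : 0 ≤ n * Kl := by positivity
      rw [hK₁]
      nlinarith
    have h12 : 1 ≤ (r ^ 3)⁻¹ * d ^ 3 := by
      rw [inv_mul_eq_div, one_le_div (by positivity)]
      exact pow_le_pow_left₀ hr.le hdr.le 3
    have h13 : d ≤ (r ^ 2)⁻¹ * d ^ 3 := by
      rw [inv_mul_eq_div, le_div_iff₀ (by positivity), pow_succ' d 2]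
      exact mul_le_mul_of_nonneg_left (pow_le_pow_left₀ hr.le hdr.le 2) hd0
    calc _ ≤ K₁ * (1 + d) := h7
      _ ≤ K₁ * ((r ^ 3)⁻¹ * d ^ 3 + (r ^ 2)⁻¹ * d ^ 3) := by gcongr
      _ = K₁ * ((r ^ 3)⁻¹ + (r ^ 2)⁻¹) * d ^ 3 := by ring
      _ ≤ _ := le_add_of_nonneg_left (by positivity)

/-- The expansion with `ε = 1` serves inside the ball, and `1 ≤ d/r` turns linear growth into a
multiple of `d` outside. Second moments of `δ` then suffice to control `G - g`. -/
lemma exists_lipschitz_bound (hg : Tendsto g atTop (𝓝 gLim)) (hl : Tendsto l atTop (𝓝 lLim))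
    (hgrow : ∃ K, ∀ᶠ N in atTop, ∀ e, |G N e| ≤ K * (1 + ‖δ N e‖))
    (hlin : ∀ ε > 0, ∃ r > 0, ∀ᶠ N in atTop, ∀ e, ‖δ N e‖ ≤ r →
      |G N e - g N - l N ⬝ᵥ δ N e| ≤ ε * ‖δ N e‖) :
    ∃ K, 0 ≤ K ∧ ∀ᶠ N in atTop, ∀ e, |G N e - g N| ≤ K * ‖δ N e‖ := by
  obtain ⟨K₀, hK₀⟩ := hgrow
  obtain ⟨Kg, hKg0, hKg⟩ := exists_eventually_norm_le hg
  obtain ⟨Kl, hKl0, hKl⟩ := exists_eventually_norm_le hl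
  obtain ⟨r, hr, hlin⟩ := hlin 1 one_pos
  refine ⟨(n * Kl + 1) + (|K₀| + Kg) * (r⁻¹ + 1), by positivity, ?_⟩
  filter_upwards [hK₀, hKg, hKl, hlin] with N h1 h2 h3 h4 e
  set d := ‖δ N e‖ with hd
  have hd0 : 0 ≤ d := norm_nonneg _
  rw [add_mul]
  rcases le_or_gt d r with hdr | hdr
  · have h5 : |l N ⬝ᵥ δ N e| ≤ n * Kl * d := (abs_dotProduct_le _ _).trans (by gcongr)
    have h6 := abs_sub_abs_le_abs_sub (G N e - g N) (l N ⬝ᵥ δ N e)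
    have h7 := h4 e hdr
    refine le_trans ?_ (le_add_of_nonneg_right (by positivity))
    linarith
  · have h6 : |G N e| ≤ |K₀| * (1 + d) := (h1 e).trans (by gcongr; exact le_abs_self _)
    have h9 : |g N| ≤ Kg := h2
    have h8 := abs_sub (G N e) (g N)
    have h10 : 0 ≤ Kg * d := by positivity
    have h12 : 1 ≤ r⁻¹ * d := by
      rw [inv_mul_eq_div, one_le_div hr]
      exact hdr.le
    calc |G N e - g N| ≤ (|K₀| + Kg) * (1 + d) := by nlinarith
      _ ≤ (|K₀| + Kg) * (r⁻¹ * d + d) := by gcongr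
      _ = (|K₀| + Kg) * (r⁻¹ + 1) * d := by ring
      _ ≤ _ := le_add_of_nonneg_left (by positivity)

lemma integrable_abs_pow_four {Ω' : Type*} [MeasurableSpace Ω'] {ν : Measure Ω'} {f : Ω' → ℝ}
    (hf : MemLp f 4 ν) : Integrable (fun e => |f e| ^ 4) ν := by
  simpa using hf.integrable_norm_pow (p := 4) (by norm_num)

lemma memLp_of_abs_le_norm {Ω' : Type*} [MeasurableSpace Ω'] {ν : Measure Ω'}
    [IsFiniteMeasure ν] {X : Ω' → Fin n → ℝ} (hX : ∀ i, MemLp (fun e => X e i) 4 ν) {f : Ω' → ℝ}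
    (hf : AEStronglyMeasurable f ν) {K : ℝ} (h : ∀ e, |f e| ≤ K * (1 + ‖X e‖)) :
    MemLp f 4 ν := by
  have h0 : MemLp (fun e => ∑ j, ‖X e j‖) 4 ν := memLp_finsetSum _ fun j _ => (hX j).norm
  have hc : MemLp (fun _ : Ω' => (1 : ℝ)) 4 ν := memLp_const 1
  have h1 : MemLp (fun e => 1 + ∑ j, ‖X e j‖) 4 ν := hc.add h0
  have h2 : MemLp (fun e => |K| * (1 + ∑ j, ‖X e j‖)) 4 ν := h1.const_mul |K|
  refine h2.of_le hf (Eventually.of_forall fun e => ?_)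
  have h3 : ‖X e‖ ≤ ∑ j, ‖X e j‖ := by simpa using norm_pow_le_sum (X e) one_ne_zero
  calc ‖f e‖ ≤ K * (1 + ‖X e‖) := h e
    _ ≤ |K| * (1 + ‖X e‖) := mul_le_mul_of_nonneg_right (le_abs_self K) (by positivity)
    _ ≤ |K| * (1 + ∑ j, ‖X e j‖) := by gcongr
    _ ≤ _ := le_abs_self _

variable [∀ N, MeasurableSpace (Ω N)] {μ : ∀ N, Measure (Ω N)}
  [∀ N, IsProbabilityMeasure (μ N)] {C : Matrix (Fin n) (Fin n) ℝ}

lemma exists_bound_mul_integral_sq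
    (hcov : ∀ i j, Tendsto (fun N : ℕ => (N : ℝ) * ∫ e, δ N e i * δ N e j ∂(μ N)) atTop
      (𝓝 (C i j))) (hδ : ∀ N i, MemLp (fun e => δ N e i) 4 (μ N)) :
    ∃ K, 0 ≤ K ∧ ∀ᶠ N : ℕ in atTop, (N : ℝ) * ∫ e, ∑ j, |δ N e j| ^ 2 ∂(μ N) ≤ K := by
  obtain ⟨K, hK0, hK⟩ := exists_eventually_norm_le (tendsto_finsetSum Finset.univ
    fun j _ => hcov j j)
  refine ⟨K, hK0, hK.mono fun N hN => ?_⟩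
  rw [integral_finsetSum, Finset.mul_sum]
  · simp only [sq_abs]
    simp only [← pow_two] at hN
    exact (le_abs_self _).trans hN
  · intro j _
    simpa using ((hδ N j).mono_exponent (p := 2) (by norm_num)).integrable_sq

/-- In `G = g + l·δ + rest`, the constant `g` disappears because `δ` is centred, and the linear term
gives the limit. The rest contributes at most `ε N E‖δ‖² + K N E‖δ‖⁴`, where the second summand is
`O(1/N)`. -/
theorem tendsto_mul_integral_mul
    (hδ : ∀ N i, MemLp (fun e => δ N e i) 4 (μ N))
    (hmean : ∀ N i, ∫ e, δ N e i ∂(μ N) = 0)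
    (hcov : ∀ i j, Tendsto (fun N : ℕ => (N : ℝ) * ∫ e, δ N e i * δ N e j ∂(μ N)) atTop
      (𝓝 (C i j)))
    (hfour : ∃ K, ∀ᶠ N : ℕ in atTop, (N : ℝ) ^ 2 * ∫ e, ∑ j, |δ N e j| ^ 4 ∂(μ N) ≤ K)
    (hG : ∀ N, AEStronglyMeasurable (G N) (μ N))
    (hg : Tendsto g atTop (𝓝 gLim)) (hl : Tendsto l atTop (𝓝 lLim))
    (hgrow : ∃ K, ∀ᶠ N in atTop, ∀ e, |G N e| ≤ K * (1 + ‖δ N e‖))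
    (hlin : ∀ ε > 0, ∃ r > 0, ∀ᶠ N in atTop, ∀ e, ‖δ N e‖ ≤ r →
      |G N e - g N - l N ⬝ᵥ δ N e| ≤ ε * ‖δ N e‖) (i : Fin n) :
    Tendsto (fun N : ℕ => (N : ℝ) * ∫ e, δ N e i * G N e ∂(μ N)) atTop
      (𝓝 (∑ j, lLim j * C i j)) := by
  have hδ2 : ∀ N i, MemLp (fun e => δ N e i) 2 (μ N) := fun N i =>
    (hδ N i).mono_exponent (by norm_num)
  have hmain : Tendsto (fun N : ℕ => ∑ j, l N j * ((N : ℝ) * ∫ e, δ N e i * δ N e j ∂(μ N))) atTop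
      (𝓝 (∑ j, lLim j * C i j)) :=
    tendsto_finsetSum _ fun j _ => ((tendsto_pi_nhds.1 hl j).mul (hcov i j))
  obtain ⟨K₂, hK₂0, hK₂⟩ := exists_bound_mul_integral_sq hcov hδ
  obtain ⟨K₄, hK₄⟩ := hfour
  obtain ⟨K₀, hK₀⟩ := id hgrow
  have hrem : Tendsto (fun N : ℕ => (N : ℝ) * ∫ e, δ N e i * (G N e - g N - l N ⬝ᵥ δ N e) ∂(μ N))
      atTop (𝓝 0) := by
    rw [Metric.tendsto_nhds]
    intro ε hε
    -- Half of `ε` goes to the quadratic term and half to the quartic one; `+ 1` keeps the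
    -- denominator positive when `K₂ = 0`.
    obtain ⟨K, hK0, hK⟩ := exists_remainder_bound hg hl hgrow hlin
      (ε := ε / (2 * (K₂ + 1))) (by positivity)
    have hlast : ∀ᶠ N : ℕ in atTop, K * K₄ / (N : ℝ) < ε / 2 :=
      (tendsto_const_div_atTop_nhds_zero_nat (K * K₄)).eventually (gt_mem_nhds (by positivity))
    filter_upwards [hK, hK₂, hK₄, hlast, eventually_gt_atTop 0] with N h1 h2 h4 h5 hN
    have hNpos : (0 : ℝ) < N := by exact_mod_cast hN
    have hint2 : Integrable (fun e => ∑ j, |δ N e j| ^ 2) (μ N) :=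
      integrable_finsetSum _ fun j _ => by simpa using (hδ2 N j).integrable_sq
    have hint4 : Integrable (fun e => ∑ j, |δ N e j| ^ 4) (μ N) :=
      integrable_finsetSum _ fun j _ => integrable_abs_pow_four (hδ N j)
    set ε' := ε / (2 * (K₂ + 1)) with hε'
    have hε'0 : 0 ≤ ε' := by positivity
    have hbound : ‖∫ e, δ N e i * (G N e - g N - l N ⬝ᵥ δ N e) ∂(μ N)‖ ≤
        ∫ e, ε' * (∑ j, |δ N e j| ^ 2) + K * (∑ j, |δ N e j| ^ 4) ∂(μ N) := by
      refine norm_integral_le_of_norm_le ((hint2.const_mul _).add (hint4.const_mul _))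
        (Eventually.of_forall fun e => ?_)
      rw [norm_mul]
      calc ‖δ N e i‖ * ‖G N e - g N - l N ⬝ᵥ δ N e‖
          ≤ ‖δ N e‖ * (ε' * ‖δ N e‖ + K * ‖δ N e‖ ^ 3) :=
            mul_le_mul (norm_le_pi_norm _ i) (h1 e) (norm_nonneg _) (norm_nonneg _)
        _ = ε' * ‖δ N e‖ ^ 2 + K * ‖δ N e‖ ^ 4 := by ring
        _ ≤ _ := by
          gcongr
          · exact norm_pow_le_sum _ two_ne_zero
          · exact norm_pow_le_sum _ four_ne_zero
    rw [integral_add (hint2.const_mul _) (hint4.const_mul _), integral_const_mul,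
      integral_const_mul] at hbound
    rw [dist_zero_right, norm_mul, Real.norm_natCast]
    have h6 : K * ((N : ℝ) * ∫ e, ∑ j, |δ N e j| ^ 4 ∂(μ N)) ≤ K * K₄ / N := by
      rw [le_div_iff₀ hNpos]
      calc _ = K * ((N : ℝ) ^ 2 * ∫ e, ∑ j, |δ N e j| ^ 4 ∂(μ N)) := by ring
        _ ≤ K * K₄ := by gcongr
    have h7 : ε' * ((N : ℝ) * ∫ e, ∑ j, |δ N e j| ^ 2 ∂(μ N)) ≤ ε / 2 := by
      calc _ ≤ ε' * K₂ := by gcongr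
        _ ≤ ε' * (K₂ + 1) := by gcongr; linarith
        _ = ε / 2 := by
          rw [hε']
          field_simp
    calc (N : ℝ) * ‖∫ e, δ N e i * (G N e - g N - l N ⬝ᵥ δ N e) ∂(μ N)‖
        ≤ N * (ε' * ∫ e, ∑ j, |δ N e j| ^ 2 ∂(μ N) + K * ∫ e, ∑ j, |δ N e j| ^ 4 ∂(μ N)) := by
          gcongr
      _ = ε' * ((N : ℝ) * ∫ e, ∑ j, |δ N e j| ^ 2 ∂(μ N)) +
          K * ((N : ℝ) * ∫ e, ∑ j, |δ N e j| ^ 4 ∂(μ N)) := by ring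
      _ < ε := by linarith
  have hsum := hmain.add hrem
  rw [add_zero] at hsum
  refine hsum.congr' ?_
  filter_upwards [hK₀] with N h1
  have hGi : Integrable (fun e => δ N e i * G N e) (μ N) :=
    (hδ2 N i).integrable_mul
      ((memLp_of_abs_le_norm (hδ N) (hG N) h1).mono_exponent (p := 2) (by norm_num))
  have hδδ : ∀ j, Integrable (fun e => l N j * (δ N e i * δ N e j)) (μ N) := fun j =>
    ((hδ2 N i).integrable_mul (hδ2 N j)).const_mul _
  have hgi : Integrable (fun e => g N * δ N e i) (μ N) :=
    ((hδ2 N i).integrable (by norm_num)).const_mul _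
  have hsubi : Integrable (fun e => δ N e i * G N e - g N * δ N e i) (μ N) := hGi.sub hgi
  have hsumi : Integrable (fun e => ∑ j, l N j * (δ N e i * δ N e j)) (μ N) :=
    integrable_finsetSum _ fun j _ => hδδ j
  have hexp : ∀ e, δ N e i * (G N e - g N - l N ⬝ᵥ δ N e) =
      δ N e i * G N e - g N * δ N e i - ∑ j, l N j * (δ N e i * δ N e j) := fun e => by
    rw [mul_sub, mul_sub, dotProduct, Finset.mul_sum, mul_comm (g N)]
    congr 1
    exact Finset.sum_congr rfl fun j _ => by ring
  simp_rw [hexp]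
  rw [integral_sub hsubi hsumi, integral_sub hGi hgi, integral_const_mul, hmean,
    integral_finsetSum _ fun j _ => hδδ j]
  simp_rw [integral_const_mul]
  rw [mul_sub, mul_sub, Finset.mul_sum, mul_zero, mul_zero, sub_zero]
  rw [Finset.sum_congr rfl fun j _ => mul_left_comm (l N j) (N : ℝ) _]
  ring

/-- `G - g` is `O(‖δ‖)` and `E‖δ‖² = O(1/N)`, so `G - g` tends to `0` in `L²`, which also disposes
of the cross term. -/
theorem tendsto_integral_sq
    (hδ : ∀ N i, MemLp (fun e => δ N e i) 4 (μ N))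
    (hcov : ∀ i j, Tendsto (fun N : ℕ => (N : ℝ) * ∫ e, δ N e i * δ N e j ∂(μ N)) atTop
      (𝓝 (C i j)))
    (hG : ∀ N, AEStronglyMeasurable (G N) (μ N))
    (hg : Tendsto g atTop (𝓝 gLim)) (hl : Tendsto l atTop (𝓝 lLim))
    (hgrow : ∃ K, ∀ᶠ N in atTop, ∀ e, |G N e| ≤ K * (1 + ‖δ N e‖))
    (hlin : ∀ ε > 0, ∃ r > 0, ∀ᶠ N in atTop, ∀ e, ‖δ N e‖ ≤ r →
      |G N e - g N - l N ⬝ᵥ δ N e| ≤ ε * ‖δ N e‖) :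
    Tendsto (fun N : ℕ => ∫ e, G N e ^ 2 ∂(μ N)) atTop (𝓝 (gLim ^ 2)) := by
  obtain ⟨K₂, hK₂0, hK₂⟩ := exists_bound_mul_integral_sq hcov hδ
  obtain ⟨K, hK0, hK⟩ := exists_lipschitz_bound hg hl hgrow hlin
  obtain ⟨K₀, hK₀⟩ := hgrow
  have hmem : ∀ᶠ N in atTop, MemLp (fun e => G N e - g N) 2 (μ N) := by
    filter_upwards [hK₀] with N h1
    exact ((memLp_of_abs_le_norm (hδ N) (hG N) h1).mono_exponent (by norm_num)).sub
      (memLp_const _)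
  have hsq : Tendsto (fun N : ℕ => ∫ e, (G N e - g N) ^ 2 ∂(μ N)) atTop (𝓝 0) := by
    refine squeeze_zero' (Eventually.of_forall fun N => integral_nonneg fun e => sq_nonneg _) ?_
      (tendsto_const_div_atTop_nhds_zero_nat (K ^ 2 * K₂))
    filter_upwards [hK, hK₂, eventually_gt_atTop 0, hmem] with N h1 h2 hN hm
    have hNpos : (0 : ℝ) < N := by exact_mod_cast hN
    have hint2 : Integrable (fun e => ∑ j, |δ N e j| ^ 2) (μ N) :=
      integrable_finsetSum _ fun j _ => by
        simpa using ((hδ N j).mono_exponent (p := 2) (by norm_num)).integrable_sq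
    have h3 : ∫ e, (G N e - g N) ^ 2 ∂(μ N) ≤ ∫ e, K ^ 2 * ∑ j, |δ N e j| ^ 2 ∂(μ N) := by
      refine integral_mono hm.integrable_sq (hint2.const_mul _) fun e => ?_
      calc (G N e - g N) ^ 2 = |G N e - g N| ^ 2 := (sq_abs _).symm
        _ ≤ (K * ‖δ N e‖) ^ 2 := by
          gcongr
          exact h1 e
        _ = K ^ 2 * ‖δ N e‖ ^ 2 := by ring
        _ ≤ _ := by
          gcongr
          exact norm_pow_le_sum _ two_ne_zero
    rw [integral_const_mul] at h3
    rw [le_div_iff₀ hNpos]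
    calc _ ≤ K ^ 2 * (∫ e, ∑ j, |δ N e j| ^ 2 ∂(μ N)) * N := by gcongr
      _ = K ^ 2 * (N * ∫ e, ∑ j, |δ N e j| ^ 2 ∂(μ N)) := by ring
      _ ≤ K ^ 2 * K₂ := by gcongr
  have hfirst : Tendsto (fun N : ℕ => ∫ e, (G N e - g N) ∂(μ N)) atTop (𝓝 0) := by
    have hsqrt : Tendsto (fun N : ℕ => Real.sqrt (∫ e, (G N e - g N) ^ 2 ∂(μ N))) atTop (𝓝 0) := by
      have := (Real.continuous_sqrt.tendsto 0).comp hsq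
      rwa [Real.sqrt_zero] at this
    refine squeeze_zero_norm' ?_ hsqrt
    filter_upwards [hmem] with N hm
    rw [Real.norm_eq_abs]
    refine Real.abs_le_sqrt ?_
    -- Nonnegative variance is Cauchy–Schwarz against the constant function `1`: the squared mean is
    -- at most the second moment.
    have := variance_nonneg (fun e => G N e - g N) (μ N)
    rw [variance_eq_sub hm] at this
    simpa using this
  have hlim := (hsq.add ((hg.const_mul 2).mul hfirst)).add (hg.pow 2)
  simp only [mul_zero, add_zero, zero_add] at hlim
  refine hlim.congr' ?_
  filter_upwards [hmem] with N hm
  have h1 : ∀ e, G N e ^ 2 = (G N e - g N) ^ 2 + 2 * g N * (G N e - g N) + g N ^ 2 := fun e => by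
    ring
  have hi := (hm.integrable (by norm_num)).const_mul (2 * g N)
  have hadd : Integrable (fun e => (G N e - g N) ^ 2 + 2 * g N * (G N e - g N)) (μ N) :=
    hm.integrable_sq.add hi
  simp_rw [h1]
  rw [integral_add hadd (integrable_const _), integral_add hm.integrable_sq hi,
    integral_const_mul]
  simp

end Asymptotics

/-! ### Limits of the regularized estimate at a fixed hyper-parameter. -/

section FixedHyperparameter

variable {m n p : ℕ}

lemma tendsto_matrix_inv {ι : Type*} {f : Filter ι} {K : ι → Matrix (Fin n) (Fin n) ℝ}
    {K₀ : Matrix (Fin n) (Fin n) ℝ} (h : Tendsto K f (𝓝 K₀)) (hK : K₀.det ≠ 0) :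
    Tendsto (fun t => (K t)⁻¹) f (𝓝 K₀⁻¹) := by
  simp only [Matrix.inv_def, Ring.inverse_eq_inv']
  exact (((Continuous.matrix_det continuous_id).tendsto K₀).comp h |>.inv₀ hK).smul
    (((Continuous.matrix_adjugate continuous_id).tendsto K₀).comp h)

lemma tendsto_mulVec {ι : Type*} {f : Filter ι} {K : ι → Matrix (Fin m) (Fin n) ℝ}
    {v : ι → Fin n → ℝ} {K₀ : Matrix (Fin m) (Fin n) ℝ} {v₀ : Fin n → ℝ}
    (hK : Tendsto K f (𝓝 K₀)) (hv : Tendsto v f (𝓝 v₀)) :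
    Tendsto (fun t => K t *ᵥ v t) f (𝓝 (K₀ *ᵥ v₀)) :=
  ((continuous_fst.matrix_mulVec continuous_snd).tendsto (K₀, v₀)).comp (hK.prodMk_nhds hv)

lemma jacobian_mulVec (K : Matrix (Fin m) (Fin n) ℝ) (θ : Fin n → ℝ) :
    jacobian (fun θ => K *ᵥ θ) θ = K := by
  ext i j
  have h : HasFDerivAt (fun θ => K *ᵥ θ) (LinearMap.toContinuousLinearMap K.mulVecLin) θ :=
    (LinearMap.toContinuousLinearMap K.mulVecLin).hasFDerivAt
  refine ((hasFDerivAt_pi'.1 h i).pderiv_eq j).trans ?_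
  simp

section Inverse

open scoped Matrix.Norms.Operator

variable {P : (Fin p → ℝ) → Matrix (Fin n) (Fin n) ℝ} {η : Fin p → ℝ}

lemma mpderiv_inv_of_entries (h : ∀ i j, ContDiffAt ℝ 2 (fun z => P z i j) η)
    (hu : IsUnit (P η).det) (k : Fin p) :
    mpderiv k (fun z => (P z)⁻¹) η = -((P η)⁻¹ * mpderiv k P η * (P η)⁻¹) :=
  mpderiv_inv ((contDiffAt_matrix h).differentiableAt two_ne_zero) hu k

lemma hessian_W_of_entries (α : ℝ) (θ : Fin n → ℝ)
    (h : ∀ i j, ContDiffAt ℝ 2 (fun z => P z i j) η) (hx : 0 < (P η).det) :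
    hessian (W α P θ) η = A α P θ η :=
  hessian_W α θ (contDiffAt_matrix h) hx

lemma mixed_derivative_W_of_entries (α : ℝ) (θ : Fin n → ℝ)
    (h : ∀ i j, ContDiffAt ℝ 2 (fun z => P z i j) η) (hu : IsUnit (P η).det)
    (hsymm : ∀ᶠ z in 𝓝 η, (P z).IsHermitian) :
    (Matrix.of fun (k : Fin p) (j : Fin n) =>
        pderiv k (fun z => pderiv j (fun θ => W α P θ z) θ) η) = B P θ η :=
  mixed_derivative_W α θ ((contDiffAt_matrix h).differentiableAt two_ne_zero) hu hsymm

lemma pderiv_affine_inv_add (h : ∀ i j, ContDiffAt ℝ 2 (fun z => P z i j) η)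
    {M : Matrix (Fin n) (Fin n) ℝ} (hu : IsUnit (P η + M).det)
    (l : Matrix (Fin n) (Fin n) ℝ →ₗ[ℝ] ℝ) (c : ℝ) (k : Fin p) :
    pderiv k (fun z => c - l (P z + M)⁻¹) η =
      l ((P η + M)⁻¹ * mpderiv k P η * (P η + M)⁻¹) := by
  have hP := (contDiffAt_matrix h).differentiableAt two_ne_zero
  have hQ := (hP.add_const M).matrix_inv hu
  have h1 := ((LinearMap.toContinuousLinearMap l).hasFDerivAt.comp η hQ.hasFDerivAt).const_sub c
  refine (h1.pderiv_eq k).trans ?_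
  change -l (fderiv ℝ (fun z => (P z + M)⁻¹) η (Pi.single k 1)) = _
  rw [← mpderiv_eq_fderiv k hQ, mpderiv_inv (hP.add_const M) hu, mpderiv_add_const, map_neg,
    neg_neg]

end Inverse

/-- `det(N⁻¹ R)` tends to `det S > 0`, so `R` is eventually invertible, and `N R⁻¹` is the inverse
of `N⁻¹ R`. -/
lemma gram_tendsto {Φ : ∀ N : ℕ, Matrix (Fin N) (Fin n) ℝ} {S : Matrix (Fin n) (Fin n) ℝ}
    (hS : S.PosDef) (hlim : Tendsto (fun N : ℕ => (N : ℝ)⁻¹ • ((Φ N)ᵀ * Φ N)) atTop (𝓝 S)) :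
    (∀ᶠ N in atTop, 0 < ((Φ N)ᵀ * Φ N).det) ∧
      Tendsto (fun N : ℕ => (N : ℝ) • ((Φ N)ᵀ * Φ N)⁻¹) atTop (𝓝 S⁻¹) := by
  have hdet : ∀ᶠ N : ℕ in atTop, 0 < ((Φ N)ᵀ * Φ N).det := by
    have h := ((Continuous.matrix_det continuous_id).tendsto S).comp hlim
    filter_upwards [h.eventually (lt_mem_nhds hS.det_pos), eventually_gt_atTop 0] with N hN hN0
    have hN0' : (0 : ℝ) < N := by exact_mod_cast hN0
    simp only [Function.comp_apply, id, Matrix.det_smul] at hN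
    exact pos_of_mul_pos_right hN (by positivity)
  refine ⟨hdet, (tendsto_matrix_inv hlim hS.det_pos.ne').congr' ?_⟩
  filter_upwards [hdet, eventually_gt_atTop 0] with N hN hN0
  have hN0' : (N : ℝ) ≠ 0 := by exact_mod_cast hN0.ne'
  apply Matrix.inv_eq_right_inv
  rw [Matrix.smul_mul, Matrix.mul_smul, smul_smul, inv_mul_cancel₀ hN0', one_smul,
    Matrix.mul_nonsing_inv _ hN.ne'.isUnit]

lemma smul_gram_inv_tendsto_zero (σ : ℝ) {R : ℕ → Matrix (Fin n) (Fin n) ℝ}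
    {T : Matrix (Fin n) (Fin n) ℝ} (h : Tendsto (fun N : ℕ => (N : ℝ) • R N) atTop (𝓝 T)) :
    Tendsto (fun N : ℕ => σ ^ 2 • R N) atTop (𝓝 0) := by
  have h1 := (tendsto_const_div_atTop_nhds_zero_nat (σ ^ 2)).smul h
  rw [zero_smul] at h1
  refine h1.congr' ?_
  filter_upwards [eventually_gt_atTop 0] with N hN0
  have hN0' : (N : ℝ) ≠ 0 := by exact_mod_cast hN0.ne'
  rw [smul_smul, div_mul_cancel₀ _ hN0']

variable {Φ : ∀ N : ℕ, Matrix (Fin N) (Fin n) ℝ} {S : Matrix (Fin n) (Fin n) ℝ}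
  {P : (Fin p → ℝ) → Matrix (Fin n) (Fin n) ℝ} {D : Set (Fin p → ℝ)} {η : Fin p → ℝ}

/-- At a fixed hyper-parameter: limits of the value and of the Jacobians of the regularized
estimator at noise-free data. -/
theorem regEstimate_limits (σ : ℝ) (θ : Fin n → ℝ) (hS : S.PosDef)
    (hlim : Tendsto (fun N : ℕ => (N : ℝ)⁻¹ • ((Φ N)ᵀ * Φ N)) atTop (𝓝 S)) (hD : IsCompact D)
    (hPpos : ∀ η ∈ D, (P η).PosDef) (hPcont : ContinuousOn P D)
    (hPsmooth : ∀ i j, ContDiffOn ℝ 2 (fun η => P η i j) (interior D)) (hη : η ∈ interior D) :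
    Tendsto (fun N : ℕ => (N : ℝ) • (regEstimate (Φ N) σ (P η) (Φ N *ᵥ θ) - θ))
        atTop (𝓝 (bias σ S P θ η)) ∧
      Tendsto (fun N : ℕ => (N : ℝ) •
          (jacobian (fun θ : Fin n → ℝ => regEstimate (Φ N) σ (P η) (Φ N *ᵥ θ)) θ - 1))
        atTop (𝓝 (biasTheta σ S P η)) ∧
      Tendsto (fun N : ℕ => (N : ℝ) •
          jacobian (fun z : Fin p → ℝ => regEstimate (Φ N) σ (P z) (Φ N *ᵥ θ)) η)
        atTop (𝓝 (biasEta σ S P θ η)) := by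
  obtain ⟨hdet, hU⟩ := gram_tendsto hS hlim
  have hM := smul_gram_inv_tendsto_zero σ hU
  obtain ⟨C, hC⟩ := exists_bound_inv_add hD hPpos hPcont
  have hbound := hM.eventually hC
  have hηD := interior_subset hη
  have hinv : Tendsto (fun N => (P η + σ ^ 2 • ((Φ N)ᵀ * Φ N)⁻¹)⁻¹) atTop (𝓝 (P η)⁻¹) := by
    have h := tendsto_const_nhds (x := P η) |>.add hM
    rw [add_zero] at h
    exact tendsto_matrix_inv h (hPpos η hηD).det_pos.ne'
  -- The formula is needed for all `z ∈ D` and all `θ` at the same `N`, because it is differentiated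
  -- in each variable.
  have heq : ∀ᶠ N in atTop, ∀ z ∈ D, ∀ θ, regEstimate (Φ N) σ (P z) (Φ N *ᵥ θ) = θ -
      σ ^ 2 • (((Φ N)ᵀ * Φ N)⁻¹ *ᵥ ((P z + σ ^ 2 • ((Φ N)ᵀ * Φ N)⁻¹)⁻¹ *ᵥ θ)) := by
    filter_upwards [hdet, hbound] with N h1 h2 z hz θ
    rw [regEstimate_eq_mlEstimate_sub h1.ne'.isUnit (hPpos z hz).det_pos.ne'.isUnit
      (h2 z hz).1.ne'.isUnit, mlEstimate_mulVec h1.ne'.isUnit]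
  refine ⟨?_, ?_, ?_⟩
  · refine Tendsto.congr' ?_ ((tendsto_mulVec hU (tendsto_mulVec hinv
      (tendsto_const_nhds (x := θ)))).const_smul (σ ^ 2)).neg
    filter_upwards [heq] with N hN
    rw [hN η hηD, sub_sub_cancel_left, smul_neg, smul_comm, Matrix.smul_mulVec]
  · refine Tendsto.congr' ?_ ((hU.mul hinv).const_smul (σ ^ 2)).neg
    filter_upwards [heq] with N hN
    have h1 : (fun θ => regEstimate (Φ N) σ (P η) (Φ N *ᵥ θ)) = fun θ =>
        (1 - σ ^ 2 • (((Φ N)ᵀ * Φ N)⁻¹ * (P η + σ ^ 2 • ((Φ N)ᵀ * Φ N)⁻¹)⁻¹)) *ᵥ θ := by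
      funext θ
      rw [hN η hηD, Matrix.sub_mulVec, Matrix.one_mulVec, Matrix.smul_mulVec,
        Matrix.mulVec_mulVec]
    rw [h1, jacobian_mulVec, sub_sub_cancel_left, smul_neg, smul_comm, Matrix.smul_mul]
  · have hsm : ∀ i j, ContDiffAt ℝ 2 (fun z => P z i j) η := fun i j =>
      (hPsmooth i j).contDiffAt (isOpen_interior.mem_nhds hη)
    refine tendsto_pi_nhds.2 fun i => tendsto_pi_nhds.2 fun k => ?_
    have h2 : Tendsto (fun N : ℕ => σ ^ 2 * (((N : ℝ) • ((Φ N)ᵀ * Φ N)⁻¹) *ᵥ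
        (((P η + σ ^ 2 • ((Φ N)ᵀ * Φ N)⁻¹)⁻¹ * mpderiv k P η *
          (P η + σ ^ 2 • ((Φ N)ᵀ * Φ N)⁻¹)⁻¹) *ᵥ θ)) i) atTop
        (𝓝 (σ ^ 2 * (S⁻¹ *ᵥ (((P η)⁻¹ * mpderiv k P η * (P η)⁻¹) *ᵥ θ)) i)) :=
      (tendsto_pi_nhds.1 (tendsto_mulVec hU (tendsto_mulVec
        ((hinv.mul tendsto_const_nhds).mul hinv) tendsto_const_nhds)) i).const_mul _
    have h3 : biasEta σ S P θ η i k =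
        σ ^ 2 * (S⁻¹ *ᵥ (((P η)⁻¹ * mpderiv k P η * (P η)⁻¹) *ᵥ θ)) i := by
      rw [biasEta, Matrix.of_apply, mpderiv_inv_of_entries hsm (hPpos η hηD).det_pos.ne'.isUnit,
        Matrix.neg_mulVec, Matrix.mulVec_neg, Pi.neg_apply, mul_neg, neg_neg]
    rw [h3]
    refine h2.congr' ?_
    filter_upwards [heq, hbound] with N hN hb
    set R := ((Φ N)ᵀ * Φ N)⁻¹ with hR
    -- Row `i` of the correction is a linear functional of the inverse kernel, so only the
    -- derivative of the inverse is needed; its minus sign cancels that of the correction.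
    let l : Matrix (Fin n) (Fin n) ℝ →ₗ[ℝ] ℝ :=
      { toFun := fun K => σ ^ 2 * (R *ᵥ (K *ᵥ θ)) i
        map_add' := fun K L => by
          rw [Matrix.add_mulVec, Matrix.mulVec_add, Pi.add_apply, mul_add]
        map_smul' := fun c K => by
          rw [Matrix.smul_mulVec, Matrix.mulVec_smul, Pi.smul_apply, smul_eq_mul,
            RingHom.id_apply, smul_eq_mul]
          ring }
    have h4 : pderiv k (fun z => regEstimate (Φ N) σ (P z) (Φ N *ᵥ θ) i) η =
        l ((P η + σ ^ 2 • R)⁻¹ * mpderiv k P η * (P η + σ ^ 2 • R)⁻¹) := by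
      rw [← pderiv_affine_inv_add hsm (hb η hηD).1.ne'.isUnit l (θ i) k]
      refine pderiv_congr k ?_
      filter_upwards [isOpen_interior.mem_nhds hη] with z hz
      rw [hN z (interior_subset hz)]
      rfl
    rw [Matrix.smul_apply, jacobian, Matrix.of_apply, h4, Matrix.smul_mulVec, Pi.smul_apply,
      smul_eq_mul, smul_eq_mul, mul_left_comm]
    rfl

end FixedHyperparameter

/-! ### From minimizers of the data cost to minimizers of the perturbed asymptotic cost. -/

section Minimizer

variable {N n p : ℕ} {σ α : ℝ} {P : (Fin p → ℝ) → Matrix (Fin n) (Fin n) ℝ}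
  {D : Set (Fin p → ℝ)} {η : Fin p → ℝ}

lemma isMinOn_W_of_isMinOn_ebCost {Φ : Matrix (Fin N) (Fin n) ℝ} (hσ : σ ≠ 0)
    (hR : 0 < (Φᵀ * Φ).det) (hPpos : ∀ η ∈ D, (P η).PosDef)
    (hdet : ∀ η ∈ D, 0 < (P η + σ ^ 2 • (Φᵀ * Φ)⁻¹).det) {y : Fin N → ℝ} (hη : η ∈ D)
    (h : IsMinOn (fun η => ebCost Φ σ α (P η) y) D η) :
    IsMinOn (W α (fun z => P z + σ ^ 2 • (Φᵀ * Φ)⁻¹) (mlEstimate Φ y)) D η := by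
  obtain ⟨c, hc⟩ := ebCost_eq_add (n := n) α hσ hR.ne'.isUnit hR y
  intro z hz
  have h1 : ebCost Φ σ α (P η) y ≤ ebCost Φ σ α (P z) y := h hz
  rw [hc (P η) (hPpos η hη).det_pos.ne'.isUnit (hdet η hη),
    hc (P z) (hPpos z hz).det_pos.ne'.isUnit (hdet z hz)] at h1
  exact le_of_add_le_add_right h1

end Minimizer

/-! ### Finiteness of the mean squared errors. -/

section Integrability

variable {N m n p : ℕ} {σ : ℝ} {P : (Fin p → ℝ) → Matrix (Fin n) (Fin n) ℝ} {D : Set (Fin p → ℝ)}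

lemma memLp_mulVec_add (K : Matrix (Fin m) (Fin N) ℝ) (v : Fin N → ℝ) (i : Fin m) :
    MemLp (fun e => (K *ᵥ (v + e)) i) 4 (noise N σ) := by
  have hc : MemLp (fun _ : Fin N → ℝ => (K *ᵥ v) i) 4 (noise N σ) := memLp_const _
  have h : (fun e => (K *ᵥ (v + e)) i) = fun e => (K *ᵥ v) i + K i ⬝ᵥ e := by
    funext e
    rw [Matrix.mulVec_add]
    rfl
  rw [h]
  exact hc.add (memLp_dotProduct_noise (K i) (by simp))

lemma memLp_mlEstimate (Φ : Matrix (Fin N) (Fin n) ℝ) (v : Fin N → ℝ) (i : Fin n) :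
    MemLp (fun e => mlEstimate Φ (v + e) i) 4 (noise N σ) := by
  simp only [mlEstimate, Matrix.mulVec_mulVec]
  exact memLp_mulVec_add _ v i

/-- No rank condition enters: `σ² K⁻¹` alone is positive definite. The regularized estimate is
therefore well behaved for every `N`. -/
lemma posDef_gram_add (Φ : Matrix (Fin N) (Fin n) ℝ) (hσ : 0 < σ) {K : Matrix (Fin n) (Fin n) ℝ}
    (hK : K.PosDef) : (Φᵀ * Φ + σ ^ 2 • K⁻¹).PosDef := by
  have h1 : (Φᵀ * Φ).PosSemidef := by simpa using Matrix.posSemidef_conjTranspose_mul_self Φ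
  exact (hK.inv.smul (by positivity : 0 < σ ^ 2)).posSemidef_add h1

lemma continuousOn_regularized_inv (Φ : Matrix (Fin N) (Fin n) ℝ) (hσ : 0 < σ)
    (hPpos : ∀ η ∈ D, (P η).PosDef) (hPcont : ContinuousOn P D) :
    ContinuousOn (fun η => (Φᵀ * Φ + σ ^ 2 • (P η)⁻¹)⁻¹) D := fun η hη =>
  tendsto_matrix_inv (tendsto_const_nhds.add
    ((tendsto_matrix_inv (hPcont η hη) (hPpos η hη).det_pos.ne').const_smul (σ ^ 2)))
    (posDef_gram_add Φ hσ (hPpos η hη)).det_pos.ne'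

lemma measurable_comp_of_continuousOn {Ω : Type*} [MeasurableSpace Ω] {f : (Fin p → ℝ) → ℝ}
    (hf : ContinuousOn f D) {X : Ω → (Fin p → ℝ)} (hX : Measurable X) (hmem : ∀ e, X e ∈ D) :
    Measurable fun e => f (X e) :=
  (continuousOn_iff_continuous_domRestrict.1 hf).measurable.comp (hX.subtype_mk (h := hmem))

/-- The selected coefficients are measurable and bounded, being a continuous function on the compact
`D` evaluated at a measurable selection; they multiply Gaussian coordinates, which have all moments.
-/
lemma memLp_regEstimate (Φ : Matrix (Fin N) (Fin n) ℝ) (hσ : 0 < σ) (hD : IsCompact D)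
    (hPpos : ∀ η ∈ D, (P η).PosDef) (hPcont : ContinuousOn P D)
    {etaHat : (Fin N → ℝ) → (Fin p → ℝ)} (hmeas : Measurable etaHat) (hmem : ∀ y, etaHat y ∈ D)
    (v : Fin N → ℝ) (i : Fin n) :
    MemLp (fun e => regEstimate Φ σ (P (etaHat (v + e))) (v + e) i) 4 (noise N σ) := by
  have hcont := continuousOn_regularized_inv Φ hσ hPpos hPcont
  change MemLp (fun e => ∑ j, (Φᵀ * Φ + σ ^ 2 • (P (etaHat (v + e)))⁻¹)⁻¹ i j *
    (Φᵀ *ᵥ (v + e)) j) 4 (noise N σ)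
  refine memLp_finsetSum _ fun j _ => ?_
  have hcij : ContinuousOn (fun η => (Φᵀ * Φ + σ ^ 2 • (P η)⁻¹)⁻¹ i j) D := fun η hη =>
    tendsto_pi_nhds.1 (tendsto_pi_nhds.1 (hcont η hη) i) j
  obtain ⟨C, hC⟩ := hD.exists_bound_of_continuousOn hcij
  have hy := memLp_mulVec_add (σ := σ) Φᵀ v j
  have hZ : Measurable fun e : Fin N → ℝ => (Φᵀ * Φ + σ ^ 2 • (P (etaHat (v + e)))⁻¹)⁻¹ i j :=
    measurable_comp_of_continuousOn hcij (hmeas.comp (measurable_const_add v)) fun e => hmem _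
  refine hy.of_le_mul (c := C) (hZ.aestronglyMeasurable.mul hy.aestronglyMeasurable)
    (Eventually.of_forall fun e => ?_)
  rw [norm_mul]
  exact mul_le_mul_of_nonneg_right (hC _ (hmem _)) (norm_nonneg _)

lemma integrable_sqError {Φ : Matrix (Fin N) (Fin n) ℝ} {θ : Fin n → ℝ}
    {est : (Fin N → ℝ) → (Fin n → ℝ)}
    (h : ∀ i, MemLp (fun e => est (Φ *ᵥ θ + e) i) 4 (noise N σ)) :
    Integrable (sqError Φ θ est) (noise N σ) := by
  have h1 : ∀ i, Integrable (fun e => (est (Φ *ᵥ θ + e) i - θ i) ^ 2) (noise N σ) := fun i =>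
    (((h i).mono_exponent (p := 2) (by norm_num)).sub (memLp_const (θ i))).integrable_sq
  exact integrable_finsetSum Finset.univ fun i _ => h1 i

end Integrability

/-! ### The excess mean squared error as a moment problem. -/

section Excess

variable {n p : ℕ} {σ α : ℝ} {Φ : ∀ N : ℕ, Matrix (Fin N) (Fin n) ℝ}
  {S : Matrix (Fin n) (Fin n) ℝ}

/-- The coefficients of the least squares error as a linear function of the noise. -/
lemma mlEstimate_apply (N : ℕ) (e : Fin N → ℝ) (i : Fin n) :
    mlEstimate (Φ N) e i = (((Φ N)ᵀ * Φ N)⁻¹ * (Φ N)ᵀ) i ⬝ᵥ e := by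
  rw [mlEstimate, Matrix.mulVec_mulVec]
  rfl

/-- Since `(R⁻¹Φᵀ)(R⁻¹Φᵀ)ᵀ = R⁻¹`, the least squares error has covariance `σ² R⁻¹`. -/
lemma mlEstimate_coeff_dotProduct {N : ℕ} (hR : IsUnit ((Φ N)ᵀ * Φ N).det) (i j : Fin n) :
    (((Φ N)ᵀ * Φ N)⁻¹ * (Φ N)ᵀ) i ⬝ᵥ (((Φ N)ᵀ * Φ N)⁻¹ * (Φ N)ᵀ) j = ((Φ N)ᵀ * Φ N)⁻¹ i j := by
  set R := (Φ N)ᵀ * Φ N with hRdef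
  have hRt : Rᵀ = R := by rw [hRdef, Matrix.transpose_mul, Matrix.transpose_transpose]
  have h : (R⁻¹ * (Φ N)ᵀ) * (R⁻¹ * (Φ N)ᵀ)ᵀ = R⁻¹ := by
    rw [Matrix.transpose_mul, Matrix.transpose_transpose, Matrix.transpose_nonsing_inv, hRt,
      Matrix.mul_assoc, ← Matrix.mul_assoc _ (Φ N), ← hRdef, Matrix.mul_nonsing_inv _ hR,
      Matrix.mul_one]
  calc _ = ((R⁻¹ * (Φ N)ᵀ) * (R⁻¹ * (Φ N)ᵀ)ᵀ) i j := rfl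
    _ = _ := by rw [h]

lemma tendsto_mul_integral_mlEstimate (σ : ℝ) (hS : S.PosDef)
    (hlim : Tendsto (fun N : ℕ => (N : ℝ)⁻¹ • ((Φ N)ᵀ * Φ N)) atTop (𝓝 S)) (i j : Fin n) :
    Tendsto (fun N : ℕ => (N : ℝ) *
      ∫ e, mlEstimate (Φ N) e i * mlEstimate (Φ N) e j ∂(noise N σ)) atTop
      (𝓝 ((σ ^ 2 • S⁻¹) i j)) := by
  obtain ⟨hdet, hU⟩ := gram_tendsto hS hlim
  have h := (tendsto_pi_nhds.1 (tendsto_pi_nhds.1 hU i) j).const_mul (σ ^ 2)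
  refine h.congr' ?_
  filter_upwards [hdet] with N hN
  simp_rw [mlEstimate_apply]
  rw [integral_dotProduct_mul_dotProduct_noise, mlEstimate_coeff_dotProduct hN.ne'.isUnit,
    Matrix.smul_apply, smul_eq_mul]
  ring

/-- Each coordinate is Gaussian with variance `σ² (R⁻¹)ⱼⱼ = O(1/N)`, and a Gaussian fourth moment is
proportional to the squared variance. -/
lemma exists_bound_integral_mlEstimate_pow_four (σ : ℝ) (hS : S.PosDef)
    (hlim : Tendsto (fun N : ℕ => (N : ℝ)⁻¹ • ((Φ N)ᵀ * Φ N)) atTop (𝓝 S)) :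
    ∃ K, ∀ᶠ N : ℕ in atTop,
      (N : ℝ) ^ 2 * ∫ e, ∑ j, |mlEstimate (Φ N) e j| ^ 4 ∂(noise N σ) ≤ K := by
  obtain ⟨hdet, hU⟩ := gram_tendsto hS hlim
  have h : Tendsto (fun N : ℕ => ∑ j, (σ ^ 2 * ((N : ℝ) • ((Φ N)ᵀ * Φ N)⁻¹) j j) ^ 2 *
      ∫ x, x ^ 4 ∂(gaussianReal 0 1)) atTop (𝓝 (∑ j, (σ ^ 2 * S⁻¹ j j) ^ 2 *
      ∫ x, x ^ 4 ∂(gaussianReal 0 1))) :=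
    tendsto_finsetSum _ fun j _ =>
      (((tendsto_pi_nhds.1 (tendsto_pi_nhds.1 hU j) j).const_mul (σ ^ 2)).pow 2).mul_const _
  obtain ⟨K, -, hK⟩ := exists_eventually_norm_le h
  refine ⟨K, ?_⟩
  filter_upwards [hK, hdet] with N hN hN2
  refine le_trans (le_of_eq ?_) ((le_abs_self _).trans hN)
  have hi : ∀ j, Integrable (fun e => |mlEstimate (Φ N) e j| ^ 4) (noise N σ) := fun j =>
    integrable_abs_pow_four (by simpa using memLp_mlEstimate (σ := σ) (Φ N) 0 j)
  rw [integral_finsetSum _ fun j _ => hi j, Finset.mul_sum]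
  refine Finset.sum_congr rfl fun j _ => ?_
  simp_rw [mlEstimate_apply]
  have habs : ∀ x : ℝ, |x| ^ 4 = x ^ 4 := fun x => Even.pow_abs (by decide) x
  simp_rw [habs]
  rw [integral_pow_four_dotProduct_noise, mlEstimate_coeff_dotProduct hN2.ne'.isUnit,
    Matrix.smul_apply, smul_eq_mul]
  ring

/-- The excess mean squared error of an estimator whose deviation from the maximum likelihood
estimate, multiplied by `N`, has a uniform first order expansion. -/
theorem tendsto_excess_mse (σ : ℝ) (θ : Fin n → ℝ) (hS : S.PosDef)
    (hlim : Tendsto (fun N : ℕ => (N : ℝ)⁻¹ • ((Φ N)ᵀ * Φ N)) atTop (𝓝 S))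
    {est : ∀ N : ℕ, (Fin N → ℝ) → (Fin n → ℝ)}
    (hest : ∀ N i, MemLp (fun e => est N (Φ N *ᵥ θ + e) i) 4 (noise N σ))
    {g : ℕ → Fin n → ℝ} {gLim : Fin n → ℝ} {l : ℕ → Matrix (Fin n) (Fin n) ℝ}
    {lLim : Matrix (Fin n) (Fin n) ℝ}
    (hg : Tendsto g atTop (𝓝 gLim)) (hl : Tendsto l atTop (𝓝 lLim))
    (hgrow : ∃ K, ∀ᶠ N : ℕ in atTop, ∀ e i,
      |(N : ℝ) * (est N (Φ N *ᵥ θ + e) i - mlEstimate (Φ N) (Φ N *ᵥ θ + e) i)| ≤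
        K * (1 + ‖mlEstimate (Φ N) e‖))
    (hlin : ∀ ε > 0, ∃ r > 0, ∀ᶠ N : ℕ in atTop, ∀ e, ‖mlEstimate (Φ N) e‖ ≤ r → ∀ i,
      |(N : ℝ) * (est N (Φ N *ᵥ θ + e) i - mlEstimate (Φ N) (Φ N *ᵥ θ + e) i) - g N i
        - l N i ⬝ᵥ mlEstimate (Φ N) e| ≤ ε * ‖mlEstimate (Φ N) e‖) :
    Tendsto (fun N : ℕ => (N : ℝ) ^ 2 *
        (mse (Φ N) σ θ (est N) - mse (Φ N) σ θ (mlEstimate (Φ N)))) atTop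
      (𝓝 (sqNorm gLim + 2 * (σ ^ 2 * (lLim * S⁻¹).trace))) := by
  obtain ⟨hdet, hU⟩ := gram_tendsto hS hlim
  set G : ∀ N : ℕ, (Fin N → ℝ) → Fin n → ℝ := fun N e i =>
    (N : ℝ) * (est N (Φ N *ᵥ θ + e) i - mlEstimate (Φ N) (Φ N *ᵥ θ + e) i) with hGdef
  have hGmem : ∀ N i, MemLp (fun e => G N e i) 4 (noise N σ) := fun N i =>
    ((hest N i).sub (memLp_mlEstimate (Φ N) _ i)).const_mul _
  have hδ : ∀ N i, MemLp (fun e => mlEstimate (Φ N) e i) 4 (noise N σ) := fun N i => by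
    simpa using memLp_mlEstimate (σ := σ) (Φ N) 0 i
  have hmean : ∀ N i, ∫ e, mlEstimate (Φ N) e i ∂(noise N σ) = 0 := fun N i => by
    simp_rw [mlEstimate_apply]
    exact integral_dotProduct_noise _
  have hcov := tendsto_mul_integral_mlEstimate σ hS hlim
  have hfour := exists_bound_integral_mlEstimate_pow_four σ hS hlim
  have hgrow' : ∀ i, ∃ K, ∀ᶠ N : ℕ in atTop, ∀ e, |G N e i| ≤ K * (1 + ‖mlEstimate (Φ N) e‖) :=
    fun i => hgrow.imp fun K hK => hK.mono fun N hN e => hN e i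
  have hlin' : ∀ i, ∀ ε > 0, ∃ r > 0, ∀ᶠ N : ℕ in atTop, ∀ e, ‖mlEstimate (Φ N) e‖ ≤ r →
      |G N e i - g N i - l N i ⬝ᵥ mlEstimate (Φ N) e| ≤ ε * ‖mlEstimate (Φ N) e‖ :=
    fun i ε hε => (hlin ε hε).imp fun r hr => ⟨hr.1, hr.2.mono fun N hN e he => hN e he i⟩
  have h1 := fun i => tendsto_mul_integral_mul (μ := fun N => noise N σ)
    (δ := fun N => mlEstimate (Φ N)) (G := fun N e => G N e i) hδ hmean hcov hfour
    (fun N => (hGmem N i).aestronglyMeasurable) (tendsto_pi_nhds.1 hg i) (tendsto_pi_nhds.1 hl i)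
    (hgrow' i) (hlin' i) i
  have h2 := fun i => tendsto_integral_sq (μ := fun N => noise N σ)
    (δ := fun N => mlEstimate (Φ N)) (G := fun N e => G N e i) hδ hcov
    (fun N => (hGmem N i).aestronglyMeasurable) (tendsto_pi_nhds.1 hg i) (tendsto_pi_nhds.1 hl i)
    (hgrow' i) (hlin' i)
  have h3 := tendsto_finsetSum Finset.univ fun i _ => (h2 i).add ((h1 i).const_mul 2)
  have hvalue : ∑ i, (gLim i ^ 2 + 2 * ∑ j, lLim i j * (σ ^ 2 • S⁻¹) i j) =
      sqNorm gLim + 2 * (σ ^ 2 * (lLim * S⁻¹).trace) := by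
    -- Symmetry of `S⁻¹` turns the entrywise pairing of `lLim` with the covariance into the trace of
    -- a product.
    have hSt : ∀ i j, S⁻¹ i j = S⁻¹ j i := fun i j => by
      have := hS.isHermitian.inv.apply j i
      simpa using this
    rw [Finset.sum_add_distrib, sqNorm, ← Finset.mul_sum]
    congr 2
    simp only [Matrix.trace, Matrix.diag, Matrix.mul_apply, Matrix.smul_apply, smul_eq_mul,
      Finset.mul_sum]
    refine Finset.sum_congr rfl fun i _ => Finset.sum_congr rfl fun j _ => ?_
    rw [hSt i j]
    ring
  rw [hvalue] at h3
  refine h3.congr' ?_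
  filter_upwards [hdet, eventually_gt_atTop 0] with N hN hN0
  have hN0' : (N : ℝ) ≠ 0 := by exact_mod_cast hN0.ne'
  have hm2 : ∀ i, MemLp (fun e => mlEstimate (Φ N) e i) 2 (noise N σ) := fun i =>
    (hδ N i).mono_exponent (by norm_num)
  have hG2 : ∀ i, MemLp (fun e => G N e i) 2 (noise N σ) := fun i =>
    (hGmem N i).mono_exponent (by norm_num)
  have hi1 : ∀ i, Integrable (fun e => G N e i ^ 2) (noise N σ) := fun i => (hG2 i).integrable_sq
  have hi2 : ∀ i, Integrable (fun e => 2 * N * (mlEstimate (Φ N) e i * G N e i)) (noise N σ) :=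
    fun i => ((hm2 i).integrable_mul (hG2 i)).const_mul _
  -- With estimate `θ̂ + G/N` and error `δ`, this is `N²(‖δ + G/N‖² - ‖δ‖²) = ‖G‖² + 2N δ·G`.
  have hpoint : ∀ e, (N : ℝ) ^ 2 * (sqError (Φ N) θ (est N) e -
      sqError (Φ N) θ (mlEstimate (Φ N)) e) =
      ∑ i, (G N e i ^ 2 + 2 * N * (mlEstimate (Φ N) e i * G N e i)) := fun e => by
    rw [sqError, sqError, sqNorm, sqNorm, ← Finset.sum_sub_distrib, Finset.mul_sum]
    refine Finset.sum_congr rfl fun i _ => ?_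
    have h4 : mlEstimate (Φ N) e i = mlEstimate (Φ N) (Φ N *ᵥ θ + e) i - θ i := by
      rw [mlEstimate_add, mlEstimate_mulVec hN.ne'.isUnit]
      simp
    rw [h4]
    simp only [hGdef, Pi.sub_apply]
    ring
  rw [mse, mse, ← integral_sub (integrable_sqError (hest N))
    (integrable_sqError (memLp_mlEstimate (Φ N) _)), ← integral_const_mul]
  have hi3 : ∀ i, Integrable (fun e => G N e i ^ 2 + 2 * N * (mlEstimate (Φ N) e i * G N e i))
      (noise N σ) := fun i => (hi1 i).add (hi2 i)
  simp_rw [hpoint]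
  rw [integral_finsetSum _ fun i _ => hi3 i]
  refine Finset.sum_congr rfl fun i _ => ?_
  rw [integral_add (hi1 i) (hi2 i), integral_const_mul]
  ring

end Excess

/-! ### Identification of the limit with the stated traces. -/

section Limit

variable {n p : ℕ} {σ : ℝ} {P : (Fin p → ℝ) → Matrix (Fin n) (Fin n) ℝ} {θ : Fin n → ℝ}
  {S : Matrix (Fin n) (Fin n) ℝ} {η : Fin p → ℝ}

lemma biasEta_eq : biasEta σ S P θ η = -(σ ^ 2 • (S⁻¹ * kernelJacobian P θ η)) := by
  ext i k
  simp [biasEta, kernelJacobian, Matrix.mul_apply, Matrix.mulVec, dotProduct]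

/-- The chain rule `b'_θ + b'_η J` assembles the total derivative of the bias; each `X + Xᵀ`
contributes twice the trace of `X`. -/
lemma excess_limit_eq (J : Matrix (Fin p) (Fin n) ℝ) :
    sqNorm (bias σ S P θ η) + (XVar σ S P η).trace + (XVarHPE σ S P θ η J).trace =
      sqNorm (bias σ S P θ η) + 2 * (σ ^ 2 *
        (-(σ ^ 2 • (S⁻¹ * ((P η)⁻¹ + kernelJacobian P θ η * J))) * S⁻¹).trace) := by
  have h : -(σ ^ 2 • (S⁻¹ * ((P η)⁻¹ + kernelJacobian P θ η * J))) =
      biasTheta σ S P η + biasEta σ S P θ η * J := by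
    rw [biasEta_eq, biasTheta, Matrix.mul_add, smul_add, neg_add, Matrix.neg_mul, Matrix.smul_mul,
      Matrix.mul_assoc]
  rw [h, XVar, XVarHPE]
  simp only [Matrix.trace_add, Matrix.trace_transpose, Matrix.trace_smul, Matrix.add_mul,
    smul_eq_mul]
  ring

end Limit

end FIR

/-! ### The empirical Bayes estimator. -/

theorem mainTheorem3
    (n p : ℕ) (σ α : ℝ) (hσ : 0 < σ) (hα : 0 < α)
    -- the true parameter and the deterministic input
    (θ₀ : Fin n → ℝ) (u : ℤ → ℝ) (hu : ∀ t : ℤ, t < 0 → u t = 0)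
    (hrank : ∀ᶠ N : ℕ in atTop, (FIR.regressor u N n).rank = n)
    (S : Matrix (Fin n) (Fin n) ℝ) (hS : S.PosDef)
    (hlim : Tendsto
      (fun N : ℕ => (N : ℝ)⁻¹ • ((FIR.regressor u N n)ᵀ * FIR.regressor u N n)) atTop (𝓝 S))
    -- the compact feasible set and the kernel matrix
    (D : Set (Fin p → ℝ)) (hD : IsCompact D)
    (P : (Fin p → ℝ) → Matrix (Fin n) (Fin n) ℝ)
    (hPpos : ∀ η ∈ D, (P η).PosDef) (hPcont : ContinuousOn P D)
    (hPsmooth : ∀ i j, ContDiffOn ℝ 2 (fun η => P η i j) (interior D))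
    -- the unique minimizer of `W(θ₀, ·)` over `D`, interior and nondegenerate
    (ηstar : Fin p → ℝ) (hηint : ηstar ∈ interior D)
    (hηmin : ∀ η ∈ D, η ≠ ηstar → FIR.W α P θ₀ ηstar < FIR.W α P θ₀ η)
    (hηhess : (FIR.hessian (FIR.W α P θ₀) ηstar).PosDef)
    -- the scaled empirical Bayes hyper-parameter estimator, as a function of the data
    (etaHat : (N : ℕ) → (Fin N → ℝ) → (Fin p → ℝ))
    (hmeas : ∀ N, Measurable (etaHat N))
    (hmem : ∀ N y, etaHat N y ∈ D)
    (hmin : ∀ N y, IsMinOn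
      (fun η => FIR.ebCost (FIR.regressor u N n) σ α (P η) y) D (etaHat N y)) :
    -- `A` and `B` are the second derivatives of `W`
    (∀ η ∈ interior D,
      FIR.hessian (FIR.W α P θ₀) η = FIR.A α P θ₀ η ∧
      (Matrix.of fun (k : Fin p) (j : Fin n) =>
        FIR.pderiv k (fun z => FIR.pderiv j (fun θ => FIR.W α P θ z) θ₀) η) = FIR.B P θ₀ η) ∧
    -- limits of the regularized estimator at fixed `η`, as a function of the maximum likelihood
    -- estimate `θ` (which is the value of the latter for the data `Φ θ`)
    (∀ η ∈ interior D,
      Tendsto (fun N : ℕ => (N : ℝ) •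
          (FIR.regEstimate (FIR.regressor u N n) σ (P η) (FIR.regressor u N n *ᵥ θ₀) - θ₀))
        atTop (𝓝 (FIR.bias σ S P θ₀ η)) ∧
      Tendsto (fun N : ℕ => (N : ℝ) •
          (FIR.jacobian (fun θ : Fin n → ℝ =>
            FIR.regEstimate (FIR.regressor u N n) σ (P η) (FIR.regressor u N n *ᵥ θ)) θ₀ - 1))
        atTop (𝓝 (FIR.biasTheta σ S P η)) ∧
      Tendsto (fun N : ℕ => (N : ℝ) •
          FIR.jacobian (fun z : Fin p → ℝ =>
            FIR.regEstimate (FIR.regressor u N n) σ (P z) (FIR.regressor u N n *ᵥ θ₀)) η)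
        atTop (𝓝 (FIR.biasEta σ S P θ₀ η))) ∧
    -- near `θ₀` the hyper-parameter estimator is a function `ζ N` of the maximum likelihood
    -- estimate; limits of its value and of its Jacobian at `θ₀`
    (∃ ζ : ℕ → (Fin n → ℝ) → (Fin p → ℝ),
      (∀ᶠ N : ℕ in atTop, ∀ᶠ θ in 𝓝 θ₀, ∀ y : Fin N → ℝ,
        FIR.mlEstimate (FIR.regressor u N n) y = θ → etaHat N y = ζ N θ) ∧
      Tendsto (fun N => ζ N θ₀) atTop (𝓝 ηstar) ∧
      (∀ᶠ N : ℕ in atTop, DifferentiableAt ℝ (ζ N) θ₀) ∧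
      Tendsto (fun N => FIR.jacobian (ζ N) θ₀) atTop
        (𝓝 (-((FIR.A α P θ₀ ηstar)⁻¹ * FIR.B P θ₀ ηstar)))) ∧
    -- the mean squared errors are finite
    (∀ N : ℕ,
      Integrable (FIR.sqError (FIR.regressor u N n) θ₀
        (fun y => FIR.regEstimate (FIR.regressor u N n) σ (P (etaHat N y)) y)) (FIR.noise N σ) ∧
      Integrable (FIR.sqError (FIR.regressor u N n) θ₀
        (FIR.mlEstimate (FIR.regressor u N n))) (FIR.noise N σ)) ∧
    -- the excess mean squared error
    Tendsto (fun N : ℕ => (N : ℝ) ^ 2 *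
        (FIR.mse (FIR.regressor u N n) σ θ₀
            (fun y => FIR.regEstimate (FIR.regressor u N n) σ (P (etaHat N y)) y)
          - FIR.mse (FIR.regressor u N n) σ θ₀ (FIR.mlEstimate (FIR.regressor u N n))))
      atTop
      (𝓝 (FIR.sqNorm (FIR.bias σ S P θ₀ ηstar)
        + (FIR.XVar σ S P ηstar).trace
        + (FIR.XVarHPE σ S P θ₀ ηstar
            (-((FIR.A α P θ₀ ηstar)⁻¹ * FIR.B P θ₀ ηstar))).trace)) := by
  have hstarD := interior_subset hηint
  have hsm : ∀ η ∈ interior D, ∀ i j, ContDiffAt ℝ 2 (fun η => P η i j) η := fun η hη i j =>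
    (hPsmooth i j).contDiffAt (isOpen_interior.mem_nhds hη)
  obtain ⟨hdet, hU⟩ := FIR.gram_tendsto hS hlim
  have hM := FIR.smul_gram_inv_tendsto_zero σ hU
  obtain ⟨C, hC⟩ := FIR.exists_bound_inv_add hD hPpos hPcont
  have hbound := hM.eventually hC
  have hreg : ∀ N i, MemLp (fun e => FIR.regEstimate (FIR.regressor u N n) σ
      (P (etaHat N (FIR.regressor u N n *ᵥ θ₀ + e))) (FIR.regressor u N n *ᵥ θ₀ + e) i) 4
      (FIR.noise N σ) := fun N i =>
    FIR.memLp_regEstimate _ hσ hD hPpos hPcont (hmeas N) (hmem N) _ i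
  obtain ⟨ζ, ⟨r₀, hr₀, hζmin⟩, hζ0, hζdiff, hζjac, hshrink, hexp⟩ :=
    FIR.exists_hyperparameter_map hD hPpos hPcont hPsmooth hηint hηmin hηhess
  -- Minimizing the data cost means minimizing the perturbed `W`, whose minimizer near `θ₀` is
  -- unique; hence all data `y` sharing a least squares estimate in the ball share the same
  -- hyper-parameter.
  have hident : ∀ᶠ N : ℕ in atTop, ∀ y : Fin N → ℝ, ∀ δ : Fin n → ℝ, ‖δ‖ ≤ r₀ →
      FIR.mlEstimate (FIR.regressor u N n) y = θ₀ + δ → etaHat N y =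
        ζ (σ ^ 2 • ((FIR.regressor u N n)ᵀ * FIR.regressor u N n)⁻¹) (θ₀ + δ) := by
    filter_upwards [hdet, hbound, hM.eventually hζmin] with N h1 h2 h3 y δ hδ hy
    refine h3 δ hδ _ (hmem N y) ?_
    rw [← hy]
    exact FIR.isMinOn_W_of_isMinOn_ebCost hσ.ne' h1 hPpos (fun η hη => (h2 η hη).1) (hmem N y)
      (hmin N y)
  refine ⟨fun η hη => ⟨?_, ?_⟩, fun η hη => FIR.regEstimate_limits σ θ₀ hS hlim hD hPpos hPcont
    hPsmooth hη, ⟨fun N => ζ (σ ^ 2 • ((FIR.regressor u N n)ᵀ * FIR.regressor u N n)⁻¹), ?_,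
    hζ0.comp hM, hM.eventually hζdiff, hζjac.comp hM⟩, fun N => ⟨FIR.integrable_sqError (hreg N),
    FIR.integrable_sqError (FIR.memLp_mlEstimate _ _)⟩, ?_⟩
  · exact FIR.hessian_W_of_entries α θ₀ (hsm η hη) (hPpos η (interior_subset hη)).det_pos
  · exact FIR.mixed_derivative_W_of_entries α θ₀ (hsm η hη)
      (hPpos η (interior_subset hη)).det_pos.ne'.isUnit
      (Filter.mem_of_superset (isOpen_interior.mem_nhds hη) fun z hz =>
        (hPpos z (interior_subset hz)).isHermitian)
  · filter_upwards [hident] with N hN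
    filter_upwards [Metric.closedBall_mem_nhds θ₀ hr₀] with θ hθ y hy
    have h := hN y (θ - θ₀) (by simpa [dist_eq_norm] using hθ) (by rw [hy]; abel)
    rwa [add_sub_cancel] at h
  · rw [FIR.excess_limit_eq]
    set K := (P ηstar)⁻¹ + FIR.kernelJacobian P θ₀ ηstar *
      -((FIR.A α P θ₀ ηstar)⁻¹ * FIR.B P θ₀ ηstar) with hK
    set R : (N : ℕ) → Matrix (Fin n) (Fin n) ℝ :=
      fun N => ((FIR.regressor u N n)ᵀ * FIR.regressor u N n)⁻¹ with hRdef
    -- `U N` is the deterministic factor of `N (θ̂ᴿ - θ̂)`, and `K` is the limiting `θ`-derivative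
    -- of the vector it multiplies.
    set U : ℕ → Matrix (Fin n) (Fin n) ℝ := fun N => -(σ ^ 2 • ((N : ℝ) • R N)) with hUdef
    have hUlim : Tendsto U atTop (𝓝 (-(σ ^ 2 • S⁻¹))) := (hU.const_smul (σ ^ 2)).neg
    obtain ⟨KU, hKU0, hKU⟩ : ∃ KU, 0 ≤ KU ∧ ∀ᶠ N in atTop, ∀ i, ‖U N i‖ ≤ KU := by
      have h := fun i => FIR.exists_eventually_norm_le (tendsto_pi_nhds.1 hUlim i)
      choose k hk0 hk using h
      refine ⟨∑ i, k i, Finset.sum_nonneg fun i _ => hk0 i, ?_⟩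
      filter_upwards [eventually_all.2 hk] with N hN i
      exact (hN i).trans (Finset.single_le_sum (fun i _ => hk0 i) (Finset.mem_univ i))
    have hrow : ∀ᶠ N in atTop, ∀ i v, |(U N *ᵥ v) i| ≤ n * KU * ‖v‖ := by
      filter_upwards [hKU] with N hN i v
      refine (FIR.abs_dotProduct_le (U N i) v).trans ?_
      gcongr
      exact hN i
    have hdiff : ∀ᶠ N : ℕ in atTop, ∀ e : Fin N → ℝ, ∀ i, (N : ℝ) *
        (FIR.regEstimate (FIR.regressor u N n) σ
          (P (etaHat N (FIR.regressor u N n *ᵥ θ₀ + e))) (FIR.regressor u N n *ᵥ θ₀ + e) i -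
        FIR.mlEstimate (FIR.regressor u N n) (FIR.regressor u N n *ᵥ θ₀ + e) i) =
        (U N *ᵥ ((P (etaHat N (FIR.regressor u N n *ᵥ θ₀ + e)) + σ ^ 2 • R N)⁻¹ *ᵥ
          (θ₀ + FIR.mlEstimate (FIR.regressor u N n) e))) i := by
      filter_upwards [hdet, hbound] with N h1 h2 e i
      have h3 := hmem N (FIR.regressor u N n *ᵥ θ₀ + e)
      rw [FIR.regEstimate_eq_mlEstimate_sub h1.ne'.isUnit (hPpos _ h3).det_pos.ne'.isUnit
        (h2 _ h3).1.ne'.isUnit, FIR.mlEstimate_add, FIR.mlEstimate_mulVec h1.ne'.isUnit]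
      simp only [hUdef, hRdef, Matrix.neg_mulVec, Matrix.smul_mulVec, Pi.neg_apply, Pi.sub_apply,
        Pi.smul_apply, smul_eq_mul]
      ring
    have hL : Tendsto (fun N => U N * K) atTop (𝓝 (-(σ ^ 2 • (S⁻¹ * K)))) := by
      have h := hUlim.mul (tendsto_const_nhds (x := K))
      rwa [Matrix.neg_mul, Matrix.smul_mul] at h
    have hg : Tendsto (fun N => U N *ᵥ ((P (ζ (σ ^ 2 • R N) θ₀) + σ ^ 2 • R N)⁻¹ *ᵥ θ₀)) atTop
        (𝓝 (FIR.bias σ S P θ₀ ηstar)) := by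
      have h := FIR.tendsto_mulVec hUlim (hshrink.comp hM)
      rw [Matrix.neg_mulVec, Matrix.smul_mulVec] at h
      exact h
    refine FIR.tendsto_excess_mse σ θ₀ hS hlim hreg hg hL ?_ fun ε hε => ?_
    · refine ⟨n * KU * (|C| * (‖θ₀‖ + 1)), ?_⟩
      filter_upwards [hdiff, hrow, hbound] with N h1 h2 h3 e i
      rw [h1 e i]
      set δ := FIR.mlEstimate (FIR.regressor u N n) e
      have h4 := (h3 _ (hmem N (FIR.regressor u N n *ᵥ θ₀ + e))).2 (θ₀ + δ)
      calc _ ≤ n * KU * _ := h2 i _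
        _ ≤ n * KU * (|C| * (‖θ₀‖ + ‖δ‖)) := by
          refine mul_le_mul_of_nonneg_left (h4.trans ?_) (by positivity)
          exact mul_le_mul (le_abs_self C) (norm_add_le _ _) (norm_nonneg _) (abs_nonneg _)
        _ ≤ n * KU * (|C| * ((‖θ₀‖ + 1) * (1 + ‖δ‖))) := by
          gcongr
          nlinarith [norm_nonneg θ₀, norm_nonneg δ, mul_nonneg (norm_nonneg θ₀) (norm_nonneg δ)]
        _ = _ := by ring
    -- Applying `U N` costs a factor `n * KU`, divided out in advance; `+ 1` avoids division by
    -- zero.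
    · obtain ⟨r, hr, hr'⟩ := hexp (ε / (n * KU + 1)) (by positivity)
      -- `r` serves the expansion, `r₀` the identification of the hyper-parameter with the smooth
      -- branch.
      refine ⟨min r r₀, lt_min hr hr₀, ?_⟩
      filter_upwards [hdiff, hrow, hM.eventually hr', hident, hdet] with N h1 h2 h3 h4 h5 e he i
      rw [h1 e i]
      set δ := FIR.mlEstimate (FIR.regressor u N n) e with hδ
      have h6 : etaHat N (FIR.regressor u N n *ᵥ θ₀ + e) = ζ (σ ^ 2 • R N) (θ₀ + δ) :=
        h4 _ δ (he.trans (min_le_right _ _))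
          (by rw [FIR.mlEstimate_add, FIR.mlEstimate_mulVec h5.ne'.isUnit])
      have h7 := h3 δ (he.trans (min_le_left _ _))
      rw [h6]
      have h8 := h2 i ((P (ζ (σ ^ 2 • R N) (θ₀ + δ)) + σ ^ 2 • R N)⁻¹ *ᵥ (θ₀ + δ) -
        (P (ζ (σ ^ 2 • R N) θ₀) + σ ^ 2 • R N)⁻¹ *ᵥ θ₀ - K *ᵥ δ)
      rw [Matrix.mulVec_sub, Matrix.mulVec_sub, Matrix.mulVec_mulVec _ (U N) K] at h8
      refine h8.trans ?_
      calc n * KU * _ ≤ n * KU * (ε / (n * KU + 1) * ‖δ‖) :=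
            mul_le_mul_of_nonneg_left h7 (by positivity)
        _ = (n * KU / (n * KU + 1)) * (ε * ‖δ‖) := by ring
        _ ≤ 1 * (ε * ‖δ‖) := by
          gcongr
          exact div_le_one_of_le₀ (by linarith) (by positivity)
        _ = ε * ‖δ‖ := one_mul _
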